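/- **Setting.** Let $d,n\ge 1$, let $P$ be a probability distribution on $\mathbb R^d\times\mathbb R$, let $(X,Y)\sim P$, and write $P^X$ for the law of $X$. Let $S_X\subset\mathbb R^d$ be a Borel set with $P^X(S_X)=1$. Assume that $Y$ is integrable and let $g(x)=\mathbb E[Y\mid X=x]$, $x\in S_X$ (a version of it). Write $\lambda$ for Lebesgue measure on $\mathbb R^d$ and $\|\cdot\|_2$ for the Euclidean norm. Assume: * (E) the noise $\varepsilon=Y-g(X)$ satisfies $\mathbb E[\varepsilon\mid X]=0$ and $\mathbb E[e^{t\varepsilon}\mid X]\le e^{\sigma^2t^2/2}$ almost surely, for every $t\in\mathbb R$; * (D) $(X_1,Y_1),\dots,(X_n,Y_n)$ are independent with common law $P$; * (L) $g$ is $L$-Lipschitz on $S_X$ for some constant $L$. A *local map* assigns to each $x\in S_X$ a Borel set $\mathcal V(x)\subset S_X$ with $x\in\mathcal V(x)$ and $\lambda(\mathcal V(x))>0$. Let $\mathcal V$ be a random local map; it may depend in an arbitrary way on the sample $(X_i,Y_i)_{i\le n}$ and on any further randomness. Put $nP_n^X(A)=\sum_{i=1}^n\mathbf 1_A(X_i)$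 and, with $0/0=0$, $$\hat g_{\mathcal V}(x)=\frac{\sum_{i=1}^nY_i\mathbf 1_{\mathcal V(x)}(X_i)}{\sum_{i=1}^n\mathbf 1_{\mathcal V(x)}(X_i)} .$$ For $V\subset S_X$ let $\operatorname{diam}(V)=\sup_{x,y\in V}\|x-y\|_2\in[0,\infty]$, and let $L(V)$ be the infimum of the constants $K\ge 0$ such that $|g(x)-g(y)|\le K\|x-y\|_2$ for all $x,y\in V$. The local map is *VC with dimension $v$* if there is a deterministic collection $\mathcal A$ of subsets of $\mathbb R^d$, of Vapnik–Chervonenkis dimension $v$, such that $\mathcal V(x)\in\mathcal A$ for all $x\in S_X$. As usual, $\mathcal A$ is required to be measurable in the following sense: for every $m\ge 0$ and every $J\subset\{1,\dots,m\}$, the set of all $(z_1,\dots,z_m)\in(\mathbb R^d)^m$ for which some $A\in\mathcal A$ satisfies $\{i: z_i\in A\}=J$ is measurable with respect to the completion of $(P^X)^{\otimes m}$. **Theorem.** Let $\delta\in(0,1/3)$ and let the local map $\mathcal V$ be VC with dimension $v\ge 1$. Assume moreover: * (X) (minimal mass) there is a function $\ell:S_X\to(0,\infty)$ such that, almost surely,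 for all $x\in S_X$, $P^X(\mathcal V(x))\ge\ell(x)\,\lambda(\mathcal V(x))$; * ($\mathcal V$ is $(\delta,n)$-large) almost surely, for all $x\in S_X$, $$n\max\bigl(P_n^X(\mathcal V(x)),\,P^X(\mathcal V(x))\bigr)\ \ge\ 8\log\!\left(\frac{4(2n+1)^v}{\delta}\right).$$ Here $P^X(\mathcal V(x))$ is the $P^X$-measure of the realized set $\mathcal V(x)$. Then, with probability at least $1-3\delta$, for all $x\in S_X$, $$|\hat g_{\mathcal V}(x)-g(x)|\ \le\ \sqrt{\frac{3\sigma^2\log\!\left(\frac{(n+1)^v}{\delta}\right)}{n\,\ell(x)\,\lambda(\mathcal V(x))}}\;+\;L(\mathcal V(x))\,\operatorname{diam}(\mathcal V(x)),$$ where $0\cdot\infty=0$ in the last product. ("With probability at least $1-3\delta$" means: on some measurable event of probability at least $1-3\delta$.) -/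

import Mathlib

open MeasureTheory ProbabilityTheory

namespace LocalReg

noncomputable section

/-- The covariate space, with the Euclidean norm. -/
abbrev E (d : ℕ) : Type := EuclideanSpace ℝ (Fin d)

/-- The sigma-algebra on pairs `(x, y)` that is generated by the covariate `x`. -/
abbrev covariateSigma (d : ℕ) : MeasurableSpace (E d × ℝ) :=
  MeasurableSpace.comap (Prod.fst : E d × ℝ → E d) inferInstance

/-- `g` is (a version of) the regression function `x ↦ 𝔼[Y | X = x]` when `(X, Y)` has law `P`. -/
def IsRegressionFunction {d : ℕ} (P : Measure (E d × ℝ)) (g : E d → ℝ) : Prop :=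
  Integrable (fun p : E d × ℝ => p.2) P ∧
    P[fun p : E d × ℝ => p.2 | covariateSigma d] =ᵐ[P] fun p => g p.1

/-- The noise `ε = Y - g(X)` is sub-Gaussian conditionally on `X` with parameter `σ ^ 2`:
`𝔼[ε | X] = 0` and `𝔼[exp (t ε) | X] ≤ exp (σ² t² / 2)` for every real `t`.
Integrability is part of the claim that these conditional expectations are finite. -/
def SubGaussianNoise {d : ℕ} (P : Measure (E d × ℝ)) (g : E d → ℝ) (σ : ℝ) : Prop :=
  Integrable (fun p : E d × ℝ => p.2 - g p.1) P ∧
    P[fun p : E d × ℝ => p.2 - g p.1 | covariateSigma d] =ᵐ[P] 0 ∧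
    ∀ t : ℝ, Integrable (fun p : E d × ℝ => Real.exp (t * (p.2 - g p.1))) P ∧
      P[fun p : E d × ℝ => Real.exp (t * (p.2 - g p.1)) | covariateSigma d]
        ≤ᵐ[P] fun _ => Real.exp (σ ^ 2 * t ^ 2 / 2)

/-- `Z 0, …, Z (n - 1)` are independent random pairs with common law `P`. -/
def IsIIDSample {d n : ℕ} {Ω : Type*} [MeasurableSpace Ω] (μ : Measure Ω)
    (P : Measure (E d × ℝ)) (Z : Fin n → Ω → E d × ℝ) : Prop :=
  (∀ i, Measurable (Z i)) ∧ (∀ i, μ.map (Z i) = P) ∧ iIndepFun Z μ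

/-- `g` is `L`-Lipschitz on `S`. -/
def IsLipschitzOnSet {d : ℕ} (S : Set (E d)) (g : E d → ℝ) (L : ℝ) : Prop :=
  ∀ x ∈ S, ∀ y ∈ S, |g x - g y| ≤ L * ‖x - y‖

/-- The local Lipschitz constant of `g` over `V`. -/
def localLip {d : ℕ} (g : E d → ℝ) (V : Set (E d)) : ℝ :=
  sInf {L : ℝ | 0 ≤ L ∧ IsLipschitzOnSet V g L}

/-- A local map on `S`: every `V x`, for `x ∈ S`, is a Borel subset of `S` that contains `x` and
has positive Lebesgue measure. -/
def IsLocalMap {d : ℕ} (S : Set (E d)) (V : E d → Set (E d)) : Prop :=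
  ∀ x ∈ S, MeasurableSet (V x) ∧ V x ⊆ S ∧ x ∈ V x ∧ 0 < volume (V x)

/-- The number of sample covariates that fall in `A`, that is `n P_n^X(A)`. -/
def count {d n : ℕ} (z : Fin n → E d × ℝ) (A : Set (E d)) : ℝ :=
  ∑ i, A.indicator (fun _ => (1 : ℝ)) (z i).1

/-- The empirical measure `P_n^X(A)` of the covariates. -/
def empMeasure {d n : ℕ} (z : Fin n → E d × ℝ) (A : Set (E d)) : ℝ :=
  count z A / n

/-- The local regression estimator at `x` (with `0 / 0 = 0`). -/
def estimator {d n : ℕ} (z : Fin n → E d × ℝ) (V : E d → Set (E d)) (x : E d) : ℝ :=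
  (∑ i, (z i).2 * (V x).indicator (fun _ => (1 : ℝ)) (z i).1) / count z (V x)

/-- The traces of the collection `𝒜` on the points `z 0, …, z (n - 1)`, as sets of indices. -/
def traces {T : Type*} (𝒜 : Set (Set T)) {n : ℕ} (z : Fin n → T) : Set (Set (Fin n)) :=
  (fun A => z ⁻¹' A) '' 𝒜

/-- The shattering coefficient. The supremum is over a set of integers bounded by `2 ^ n`. -/
def shatterCoeff {T : Type*} (𝒜 : Set (Set T)) (n : ℕ) : ℕ :=
  ⨆ z : Fin n → T, (traces 𝒜 z).ncard

/-- The Vapnik-Chervonenkis dimension. -/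
def vcDim {T : Type*} (𝒜 : Set (Set T)) : ℕ∞ :=
  ⨆ n ∈ {n : ℕ | shatterCoeff 𝒜 n = 2 ^ n}, (n : ℕ∞)

/-- The usual measurability requirement on a class of sets indexing an empirical process: for each
pattern `J`, the event that some member of `𝒜` picks out exactly the points with index in `J`
among finitely many independent points with law `Q` is measurable, up to null sets.
It rules out the classes for which uniform laws of large numbers fail in spite of a finite
VC dimension. -/
def TraceMeasurable {d : ℕ} (Q : Measure (E d)) (𝒜 : Set (Set (E d))) : Prop :=
  ∀ (m : ℕ) (J : Set (Fin m)),
    NullMeasurableSet {z : Fin m → E d | J ∈ traces 𝒜 z} (Measure.pi fun _ => Q)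

/-- The random local map `𝒱` is VC with dimension `v`: its values all lie in one deterministic
(measurable) collection of VC dimension `v`. -/
def IsVCLocalMap {d : ℕ} {Ω : Type*} (Q : Measure (E d)) (S : Set (E d))
    (𝒱 : Ω → E d → Set (E d)) (v : ℕ) : Prop :=
  ∃ 𝒜 : Set (Set (E d)), vcDim 𝒜 = v ∧ TraceMeasurable Q 𝒜 ∧ ∀ ω, ∀ x ∈ S, 𝒱 ω x ∈ 𝒜

/-- Minimal mass: almost surely, `P^X(𝒱(x)) ≥ ℓ(x) λ(𝒱(x))` for all `x ∈ S`, with `ℓ > 0`. -/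
def MinimalMass {d : ℕ} {Ω : Type*} [MeasurableSpace Ω] (μ : Measure Ω) (Q : Measure (E d))
    (S : Set (E d)) (𝒱 : Ω → E d → Set (E d)) (ℓ : E d → ℝ) : Prop :=
  (∀ x ∈ S, 0 < ℓ x) ∧
    ∀ᵐ ω ∂μ, ∀ x ∈ S, ENNReal.ofReal (ℓ x) * volume (𝒱 ω x) ≤ Q (𝒱 ω x)

/-- `(δ, n)`-largeness of a random local map with VC dimension `v`. -/
def IsLarge {d n : ℕ} {Ω : Type*} [MeasurableSpace Ω] (μ : Measure Ω) (Q : Measure (E d))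
    (Z : Fin n → Ω → E d × ℝ) (S : Set (E d)) (𝒱 : Ω → E d → Set (E d)) (v : ℕ) (δ : ℝ) : Prop :=
  ∀ᵐ ω ∂μ, ∀ x ∈ S,
    8 * Real.log (4 * (2 * (n : ℝ) + 1) ^ v / δ)
      ≤ n * max (empMeasure (fun i => Z i ω) (𝒱 ω x)) (Q.real (𝒱 ω x))

end

end LocalReg

/-!
For a set `A` write `N` for the number of sample covariates in `A`, `q = n P^X(A)` for its expected
value and `M` for the modulus of the sum of the noise over the sample points in `A`. The error at
`x`, with `A = 𝒱(x)`, is the noise average, of modulus `M / N`, plus an average of the differences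
`g(X_i) - g(x)` over points of `A`. The latter is at most `L(A) diam(A)`, and since
`n ℓ(x) λ(A) ≤ q` it remains to show that with probability at least `1 - 3 δ` every large measurable
set `A` of the class has `N > 0` and `M ≤ N √(3 σ² a / q)`, where `a = log ((n + 1)^v / δ)`.

* If `N ≥ 2 q / 3`, a violation forces `M ≥ √(2 σ² a N)`. Given the covariates, only the at most
  `(n + 1)^v` traces of the class matter (`card_traceFinset_le`), and a sub-Gaussian union bound
  gives total probability at most `2 δ` (`measure_exists_noise_le`).

* If `N < 2 q / 3`, largeness means `q ≥ 8 b` with `b = log (4 (2 n + 1)^v / δ)`. At mass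
  `8 b`, the union bound below gives a deficient count alone an exponent of only about `b / 4`,
  which is not enough. It has to be combined with the noise, whose deviation at the threshold
  `N = 2 q / 3` has exponent `a`.
  `measure_exists_mass_count_noise_le` bounds, uniformly over the class, the probability that
  `lam q - θ N + t M - σ² t² N / 2 ≥ κ` by `2 (2 n + 1)^v exp (-κ)` whenever
  `exp (-θ) + exp lam ≤ 2`. With `lam = log (6 / 5)` and `θ = log (5 / 4)` it yields the exponent
  `a + b / 4` for `8 b ≤ q ≤ 40 b`, and, without noise, `4 b / 3` for larger `q`. Together these
  events have probability at most `δ` (`deviation_budget_le`).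

The uniform bound is proved with a ghost sample. By Jensen's inequality `exp (lam q)` is at most the
expectation of `exp (lam N')` for the count `N'` in the ghost sample (`le_ghostWeight`), so no
constant is lost in the symmetrization. The supremum over the class is bounded by the sum over the
traces on the double sample, and the average over exchanges of sample points with their ghost copies
is at most one for every trace (`sum_doubleWeight_map_swapPerm_le`).

Bad events are bounded in outer measure, as they need not be measurable; events about traces are
replaced by measurable hulls, which trace measurability makes harmless.
-/

namespace LocalReg

open scoped ENNReal

/-! ### Sauer–Shelah bound for the traces -/

open Finset in
open Classical in
/-- The traces of `𝒜` on a finite family of points, as finite sets of indices. -/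
noncomputable def traceFinset {T ι : Type*} [Fintype ι] (𝒜 : Set (Set T)) (z : ι → T) :
    Finset (Finset ι) :=
  {J | ∃ A ∈ 𝒜, z ⁻¹' A = (J : Set ι)}

lemma mem_traceFinset {T ι : Type*} [Fintype ι] {𝒜 : Set (Set T)} {z : ι → T} {J : Finset ι} :
    J ∈ traceFinset 𝒜 z ↔ ∃ A ∈ 𝒜, z ⁻¹' A = (J : Set ι) := by
  classical
  simp [traceFinset]

lemma shatterCoeff_eq_of_traces_eq_univ {T : Type*} {𝒜 : Set (Set T)} {k : ℕ} {z : Fin k → T}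
    (h : traces 𝒜 z = Set.univ) : shatterCoeff 𝒜 k = 2 ^ k := by
  have hle : ∀ w : Fin k → T, (traces 𝒜 w).ncard ≤ 2 ^ k := fun w => by
    refine (Set.ncard_le_ncard (Set.subset_univ _)).trans ?_
    simp [Set.ncard_univ]
  have : Nonempty (Fin k → T) := ⟨z⟩
  refine le_antisymm (ciSup_le hle) ?_
  refine le_trans ?_ (le_ciSup (f := fun w : Fin k → T => (traces 𝒜 w).ncard)
    ⟨2 ^ k, by rintro _ ⟨w, rfl⟩; exact hle w⟩ z)
  simp [h, Set.ncard_univ]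

lemma card_le_of_shatters_traceFinset {T ι : Type*} [Fintype ι] [DecidableEq ι]
    {𝒜 : Set (Set T)} {v : ℕ}
    (hv : vcDim 𝒜 ≤ v) {z : ι → T} {s : Finset ι} (hs : (traceFinset 𝒜 z).Shatters s) :
    s.card ≤ v := by
  let e : Fin s.card → ι := fun i => (s.equivFin.symm i : ι)
  have he : Function.Injective e := Subtype.val_injective.comp s.equivFin.symm.injective
  have hes : ∀ i, e i ∈ s := fun i => (s.equivFin.symm i).2
  have huniv : traces 𝒜 (z ∘ e) = Set.univ := by
    rw [Set.eq_univ_iff_forall]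
    intro J
    classical
    have ht : (Finset.univ.filter (· ∈ J)).image e ⊆ s := by
      intro i hi
      obtain ⟨j, -, rfl⟩ := Finset.mem_image.1 hi
      exact hes j
    obtain ⟨u, hu, hsu⟩ := hs ht
    obtain ⟨A, hA, hAu⟩ := mem_traceFinset.1 hu
    refine ⟨A, hA, ?_⟩
    ext i
    have h1 : e i ∈ u ↔ i ∈ J := by
      have := congrArg (e i ∈ ·) hsu
      simpa [hes i, he.eq_iff] using this
    rw [← h1, ← Finset.mem_coe, ← hAu]
    rfl
  have h := shatterCoeff_eq_of_traces_eq_univ huniv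
  have h2 : ((s.card : ℕ) : ℕ∞) ≤ vcDim 𝒜 := le_iSup₂_of_le s.card h le_rfl
  exact_mod_cast h2.trans hv

lemma sum_Iic_choose_le_pow (m v : ℕ) : ∑ k ∈ Finset.Iic v, m.choose k ≤ (m + 1) ^ v := by
  rw [show Finset.Iic v = Finset.range (v + 1) by ext; simp]
  induction v with
  | zero => simp
  | succ v ih =>
    rw [Finset.sum_range_succ]
    calc _ ≤ (m + 1) ^ v + m ^ (v + 1) := add_le_add ih (Nat.choose_le_pow _ _)
      _ ≤ (m + 1) ^ v + (m + 1) ^ v * m := by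
        rw [pow_succ]; gcongr; omega
      _ = (m + 1) ^ (v + 1) := by ring

/-- The Sauer–Shelah bound. -/
lemma card_traceFinset_le {T ι : Type*} [Fintype ι] {𝒜 : Set (Set T)} {v : ℕ}
    (hv : vcDim 𝒜 ≤ v) (z : ι → T) :
    (traceFinset 𝒜 z).card ≤ (Fintype.card ι + 1) ^ v := by
  classical
  refine (Finset.card_le_card_shatterer _).trans <| Finset.card_shatterer_le_sum_vcDim.trans ?_
  refine le_trans ?_ (sum_Iic_choose_le_pow _ v)
  refine Finset.sum_le_sum_of_subset (Finset.Iic_subset_Iic.2 ?_)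
  exact Finset.sup_le fun s hs =>
    card_le_of_shatters_traceFinset hv (Finset.mem_shatterer.1 hs)

/-! ### Sub-Gaussian noise given the covariates -/

lemma measurePi_mono {ι : Type*} [Fintype ι] {α : ι → Type*} [∀ i, MeasurableSpace (α i)]
    {μ ν : ∀ i, Measure (α i)} [∀ i, SigmaFinite (μ i)] (h : ∀ i, μ i ≤ ν i) :
    Measure.pi μ ≤ Measure.pi ν := by
  have key : (Measure.pi μ).toOuterMeasure ≤ OuterMeasure.pi fun i => (ν i).toOuterMeasure := by
    refine OuterMeasure.le_pi.2 fun s _ => ?_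
    calc Measure.pi μ (Set.univ.pi s) = ∏ i, μ i (s i) := Measure.pi_pi μ s
      _ ≤ ∏ i, ν i (s i) := Finset.prod_le_prod' fun i _ => h i (s i)
  refine Measure.le_iff.2 fun s hs => ?_
  rw [Measure.pi_def ν, toMeasure_apply _ _ hs]
  exact key s

lemma measurePi_smul {ι : Type*} [Fintype ι] {α : ι → Type*} [∀ i, MeasurableSpace (α i)]
    (μ : ∀ i, Measure (α i)) [∀ i, IsFiniteMeasure (μ i)] {c : ι → ℝ≥0∞} (hc : ∀ i, c i ≠ ∞) :
    Measure.pi (fun i => c i • μ i) = (∏ i, c i) • Measure.pi μ := by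
  have : ∀ i, IsFiniteMeasure (c i • μ i) := fun i => Measure.smul_finite _ (hc i)
  refine Measure.pi_eq fun s _ => ?_
  simp [Measure.pi_pi, Finset.prod_mul_distrib]

/-- If `f i` integrates over every set of the form `{x ∈ B}` to at most `c i` times the mass of
that set, the product of the `f i (z i)` costs at most `∏ c i` against any function of the
covariates of an independent sample. This replaces conditioning on the covariates. -/
lemma lintegral_mul_prod_le {X Y : Type*} [MeasurableSpace X] [MeasurableSpace Y]
    {P : Measure (X × Y)} [IsProbabilityMeasure P] {ι : Type*} [Fintype ι]
    {f : ι → X × Y → ℝ≥0∞} (hf : ∀ i, Measurable (f i)) {c : ι → ℝ≥0∞} (hc : ∀ i, c i ≠ ∞)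
    (h : ∀ i, ∀ B : Set X, MeasurableSet B →
      ∫⁻ p in Prod.fst ⁻¹' B, f i p ∂P ≤ c i * P.fst B)
    {C : (ι → X) → ℝ≥0∞} (hC : Measurable C) :
    ∫⁻ z, C (fun i => (z i).1) * ∏ i, f i (z i) ∂(Measure.pi fun _ : ι => P)
      ≤ (∏ i, c i) * ∫⁻ x, C x ∂(Measure.pi fun _ : ι => P.fst) := by
  have hfst : Measurable fun (z : ι → X × Y) i => (z i).1 := by fun_prop
  have hD : Measurable fun z : ι → X × Y => ∏ i, f i (z i) :=
    Finset.measurable_prod _ fun i _ => (hf i).comp (measurable_pi_apply i)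
  let ν : ι → Measure X := fun i => (P.withDensity (f i)).map Prod.fst
  have hνle : ∀ i, ν i ≤ c i • P.fst := fun i => Measure.le_iff.2 fun B hB => by
    rw [Measure.map_apply measurable_fst hB, withDensity_apply _ (measurable_fst hB)]
    exact h i B hB
  have hνfin : ∀ i, IsFiniteMeasure (ν i) := fun i =>
    have := Measure.smul_finite P.fst (hc i)
    isFiniteMeasure_of_le _ (hνle i)
  have hpi : Measure.pi ν = ((Measure.pi fun _ : ι => P).withDensity
      fun z => ∏ i, f i (z i)).map fun z i => (z i).1 := by
    refine Measure.pi_eq fun s hs => ?_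
    have hpre : (fun (z : ι → X × Y) i => (z i).1) ⁻¹' Set.univ.pi s
        = Set.univ.pi fun i => Prod.fst ⁻¹' s i := by ext; simp
    have hms : MeasurableSet (Set.univ.pi s) := .univ_pi hs
    rw [Measure.map_apply hfst hms, withDensity_apply _ (hfst hms),
      ← lintegral_indicator (hfst hms)]
    have hprod : ∀ z : ι → X × Y,
        ((fun (z : ι → X × Y) i => (z i).1) ⁻¹' Set.univ.pi s).indicator
          (fun z => ∏ i, f i (z i)) z
          = ∏ i, (Prod.fst ⁻¹' s i).indicator (f i) (z i) := fun z => by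
      rw [hpre]
      by_cases hz : z ∈ Set.univ.pi fun i => Prod.fst ⁻¹' s i
      · rw [Set.indicator_of_mem hz]
        exact Finset.prod_congr rfl fun i _ => (Set.indicator_of_mem (hz i trivial) _).symm
      · rw [Set.indicator_of_notMem hz]
        obtain ⟨i, hi⟩ : ∃ i, z i ∉ Prod.fst ⁻¹' s i := by simpa [Set.mem_pi] using hz
        exact (Finset.prod_eq_zero (Finset.mem_univ i) (Set.indicator_of_notMem hi _)).symm
    have hmeas : ∀ i, Measurable ((Prod.fst ⁻¹' s i).indicator (f i)) := fun i =>
      (hf i).indicator (measurable_fst (hs i))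
    rw [lintegral_congr hprod,
      lintegral_prod_eq_prod_lintegral_of_indepFun Finset.univ
        (fun i (z : ι → X × Y) => (Prod.fst ⁻¹' s i).indicator (f i) (z i))
        (iIndepFun_pi fun i => (hmeas i).aemeasurable)
        fun i => (hmeas i).comp (measurable_pi_apply i)]
    refine Finset.prod_congr rfl fun i _ => ?_
    rw [(measurePreserving_eval (fun _ : ι => P) i).lintegral_comp (hmeas i),
      lintegral_indicator (measurable_fst (hs i)), Measure.map_apply measurable_fst (hs i),
      withDensity_apply _ (measurable_fst (hs i))]
  calc ∫⁻ z, C (fun i => (z i).1) * ∏ i, f i (z i) ∂(Measure.pi fun _ : ι => P)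
      = ∫⁻ x, C x ∂Measure.pi ν := by
        rw [hpi, lintegral_map hC hfst]
        refine (lintegral_congr fun z => ?_).trans
          (lintegral_withDensity_eq_lintegral_mul _ hD (hC.comp hfst)).symm
        simp [mul_comm]
    _ ≤ ∫⁻ x, C x ∂((∏ i, c i) • Measure.pi fun _ : ι => P.fst) := by
        rw [← measurePi_smul _ hc]
        exact lintegral_mono' (measurePi_mono hνle) le_rfl
    _ = _ := by rw [lintegral_smul_measure]; rfl

/-- `e` is a measurable noise variable that is sub-Gaussian given the covariate, stated through
integrals over the events that the covariate determines. -/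
def IsSubGaussianGiven {X : Type*} [MeasurableSpace X] (P : Measure (X × ℝ)) (e : X × ℝ → ℝ)
    (σ : ℝ) : Prop :=
  Measurable e ∧ ∀ t : ℝ, ∀ B : Set X, MeasurableSet B →
    ∫⁻ p in Prod.fst ⁻¹' B, ENNReal.ofReal (Real.exp (t * e p)) ∂P
      ≤ ENNReal.ofReal (Real.exp (σ ^ 2 * t ^ 2 / 2)) * P.fst B

lemma IsSubGaussianGiven.mono {X : Type*} [MeasurableSpace X] {P : Measure (X × ℝ)}
    {e : X × ℝ → ℝ} {σ τ : ℝ} (h : IsSubGaussianGiven P e σ) (hστ : σ ^ 2 ≤ τ ^ 2) :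
    IsSubGaussianGiven P e τ :=
  ⟨h.1, fun t B hB => (h.2 t B hB).trans <| by gcongr⟩

lemma SubGaussianNoise.exists_isSubGaussianGiven {d : ℕ} {P : Measure (E d × ℝ)}
    [IsProbabilityMeasure P] {g : E d → ℝ} {σ : ℝ} (h : SubGaussianNoise P g σ) :
    ∃ e : E d × ℝ → ℝ, (e =ᵐ[P] fun p => p.2 - g p.1) ∧ IsSubGaussianGiven P e σ := by
  obtain ⟨hint, -, hexp⟩ := h
  obtain ⟨e, he, hee⟩ := hint.1.aemeasurable
  refine ⟨e, hee.symm, he, fun t B hB => ?_⟩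
  obtain ⟨hti, htle⟩ := hexp t
  have hm : covariateSigma d ≤ (inferInstance : MeasurableSpace (E d × ℝ)) :=
    measurable_fst.comap_le
  have hBm : MeasurableSet[covariateSigma d] (Prod.fst ⁻¹' B : Set (E d × ℝ)) := ⟨B, hB, rfl⟩
  have hce : ∫⁻ p in Prod.fst ⁻¹' B, ENNReal.ofReal (Real.exp (t * e p)) ∂P
      = ∫⁻ p in Prod.fst ⁻¹' B, ENNReal.ofReal (Real.exp (t * (p.2 - g p.1))) ∂P := by
    refine lintegral_congr_ae (ae_restrict_of_ae ?_)
    filter_upwards [hee] with p hp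
    rw [hp]
  rw [hce, ← ofReal_integral_eq_lintegral_ofReal hti.integrableOn
    (ae_of_all _ fun p => (Real.exp_pos _).le), ← setIntegral_condExp hm hti hBm]
  calc ENNReal.ofReal (∫ p in Prod.fst ⁻¹' B,
        (P[fun p : E d × ℝ => Real.exp (t * (p.2 - g p.1)) | covariateSigma d]) p ∂P)
      ≤ ENNReal.ofReal (∫ _ in Prod.fst ⁻¹' B, Real.exp (σ ^ 2 * t ^ 2 / 2) ∂P) := by
        refine ENNReal.ofReal_le_ofReal ?_
        exact integral_mono_ae integrable_condExp.integrableOn (integrable_const _)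
          (ae_restrict_of_ae htle)
    _ = _ := by
        rw [setIntegral_const, smul_eq_mul, ENNReal.ofReal_mul measureReal_nonneg,
          ofReal_measureReal, Measure.fst_apply hB, mul_comm]

/-- The sum of `e` over the sample points with index in `J` is sub-Gaussian with variance proxy
`σ² |J|`, given the covariates. -/
lemma IsSubGaussianGiven.lintegral_mul_exp_sum_le {X : Type*} [MeasurableSpace X]
    {P : Measure (X × ℝ)} [IsProbabilityMeasure P] {e : X × ℝ → ℝ} {σ : ℝ}
    (h : IsSubGaussianGiven P e σ) {ι : Type*} [Fintype ι] {C : (ι → X) → ℝ≥0∞}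
    (hC : Measurable C) (J : Finset ι) (t : ℝ) :
    ∫⁻ z, C (fun i => (z i).1) * ENNReal.ofReal
        (Real.exp (t * ∑ i ∈ J, e (z i) - σ ^ 2 * t ^ 2 / 2 * J.card)) ∂(Measure.pi fun _ : ι => P)
      ≤ ∫⁻ x, C x ∂(Measure.pi fun _ : ι => P.fst) := by
  classical
  have hm := h.1
  let f : ι → X × ℝ → ℝ≥0∞ := fun i p =>
    if i ∈ J then ENNReal.ofReal (Real.exp (t * e p - σ ^ 2 * t ^ 2 / 2)) else 1
  have hf : ∀ i, Measurable (f i) := fun i => by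
    by_cases hi : i ∈ J
    · simp only [f, hi, if_true]; fun_prop
    · simp only [f, hi, if_false]; fun_prop
  have hle : ∀ i, ∀ B : Set X, MeasurableSet B →
      ∫⁻ p in Prod.fst ⁻¹' B, f i p ∂P ≤ 1 * P.fst B := fun i B hB => by
    by_cases hi : i ∈ J
    · simp only [f, hi, if_true, sub_eq_add_neg, Real.exp_add,
        ENNReal.ofReal_mul (Real.exp_pos _).le]
      rw [lintegral_mul_const' _ _ ENNReal.ofReal_ne_top]
      refine (mul_le_mul_left (h.2 t B hB) _).trans_eq ?_
      rw [mul_right_comm, ← ENNReal.ofReal_mul (Real.exp_pos _).le, ← Real.exp_add]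
      simp
    · simp [f, hi, Measure.fst_apply hB]
  refine le_trans (le_of_eq ?_)
    ((lintegral_mul_prod_le hf (fun _ => ENNReal.one_ne_top) hle hC).trans_eq (by simp))
  refine lintegral_congr fun z => ?_
  congr 1
  simp only [f, Finset.prod_ite_mem, Finset.univ_inter]
  rw [← ENNReal.ofReal_prod_of_nonneg fun _ _ => (Real.exp_pos _).le, ← Real.exp_sum,
    Finset.sum_sub_distrib, Finset.mul_sum]
  simp [mul_comm]

/-- Union bound over index sets `J` and over both signs of the noise sum: the event that some `J`
has weight `C J (x)` times the exponential of the compensated noise sum at least `exp κ`. No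
measurability of the event `B` is needed. -/
lemma IsSubGaussianGiven.measure_le_of_exists {X : Type*} [MeasurableSpace X]
    {P : Measure (X × ℝ)} [IsProbabilityMeasure P] {e : X × ℝ → ℝ} {σ : ℝ}
    (h : IsSubGaussianGiven P e σ) {ι : Type*} [Fintype ι] {C : Finset ι → (ι → X) → ℝ≥0∞}
    (hC : ∀ J, Measurable (C J)) (t : Finset ι → ℝ) (κ : ℝ) {B : Set (ι → X × ℝ)}
    (hB : ∀ z ∈ B, ∃ J, ENNReal.ofReal (Real.exp κ) ≤ C J (fun i => (z i).1) * ENNReal.ofReal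
        (Real.exp (t J * |∑ i ∈ J, e (z i)| - σ ^ 2 * t J ^ 2 / 2 * J.card))) :
    (Measure.pi fun _ : ι => P) B ≤ ENNReal.ofReal (Real.exp (-κ)) *
      (2 * ∑ J, ∫⁻ x, C J x ∂(Measure.pi fun _ : ι => P.fst)) := by
  have hm := h.1
  let H : Finset ι → ℝ → (ι → X × ℝ) → ℝ≥0∞ := fun J s z =>
    C J (fun i => (z i).1) * ENNReal.ofReal
        (Real.exp (s * ∑ i ∈ J, e (z i) - σ ^ 2 * s ^ 2 / 2 * J.card))
  have hH : ∀ J s, Measurable (H J s) := fun J s =>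
    ((hC J).comp (by fun_prop)).mul (by fun_prop)
  have hsub : B ⊆ {z | ENNReal.ofReal (Real.exp κ) ≤ ∑ J, (H J (t J) z + H J (-t J) z)} := by
    intro z hz
    obtain ⟨J, hJ⟩ := hB z hz
    refine le_trans (hJ.trans ?_) (Finset.single_le_sum (f := fun J => H J (t J) z + H J (-t J) z)
      (fun _ _ => zero_le) (Finset.mem_univ J))
    rcases abs_choice (∑ i ∈ J, e (z i)) with hs | hs
    · rw [hs]; exact le_self_add
    · rw [hs]
      refine le_trans (le_of_eq ?_) le_add_self
      simp [H]
  have hpos : ENNReal.ofReal (Real.exp κ) ≠ 0 := by simp [Real.exp_pos]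
  refine (measure_mono hsub).trans <| (meas_ge_le_lintegral_div
    (Finset.measurable_sum _ fun J _ => (hH J _).add (hH J _)).aemeasurable hpos
      ENNReal.ofReal_ne_top).trans ?_
  rw [ENNReal.div_eq_inv_mul, Real.exp_neg, ENNReal.ofReal_inv_of_pos (Real.exp_pos _)]
  gcongr
  rw [lintegral_finsetSum _ fun J _ => (hH J _).add (hH J _), Finset.mul_sum]
  refine Finset.sum_le_sum fun J _ => ?_
  simp only [Pi.add_apply]
  rw [lintegral_add_left (hH J _), two_mul]
  exact add_le_add (h.lintegral_mul_exp_sum_le (hC J) J _)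
    (h.lintegral_mul_exp_sum_le (hC J) J _)

/-! ### Ghost sample and deviation bounds uniform over the class -/

lemma measurePreserving_comp_equiv {X ι κ : Type*} [MeasurableSpace X] [Fintype ι] [Fintype κ]
    (Q : Measure X) [IsProbabilityMeasure Q] (π : κ ≃ ι) :
    MeasurePreserving (fun z : ι → X => z ∘ π) (Measure.pi fun _ => Q) (Measure.pi fun _ => Q) := by
  have hm : Measurable fun z : ι → X => z ∘ π := by
    rw [measurable_pi_iff]
    exact fun j => measurable_pi_apply (π j)
  refine ⟨hm, (Measure.pi_eq fun s hs => ?_).symm⟩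
  rw [Measure.map_apply hm (.univ_pi hs),
    show (fun z : ι → X => z ∘ π) ⁻¹' Set.univ.pi s = Set.univ.pi fun i => s (π.symm i) by
      ext z
      simp only [Set.mem_preimage, Set.mem_univ_pi, Function.comp_apply]
      exact ⟨fun h i => by simpa using h (π.symm i), fun h j => by simpa using h (π j)⟩,
    Measure.pi_pi]
  exact Fintype.prod_equiv π.symm _ _ fun _ => rfl

lemma mem_traceFinset_comp_equiv {T ι κ : Type*} [Fintype ι] [Fintype κ] {𝒜 : Set (Set T)}
    {z : ι → T} (π : κ ≃ ι) {J : Finset κ} :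
    J ∈ traceFinset 𝒜 (z ∘ π) ↔ J.map π.toEmbedding ∈ traceFinset 𝒜 z := by
  simp only [mem_traceFinset]
  refine exists_congr fun A => and_congr_right fun _ => ?_
  rw [Set.preimage_comp, Finset.coe_map, Equiv.coe_toEmbedding, Equiv.eq_image_iff_symm_image_eq,
    Equiv.image_symm_eq_preimage]

lemma TraceMeasurable.nullMeasurableSet {d : ℕ} {Q : Measure (E d)} [IsProbabilityMeasure Q]
    {𝒜 : Set (Set (E d))} (hT : TraceMeasurable Q 𝒜) {ι : Type*} [Fintype ι] (J : Finset ι) :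
    NullMeasurableSet {z : ι → E d | J ∈ traceFinset 𝒜 z} (Measure.pi fun _ => Q) := by
  let π := (Fintype.equivFin ι).symm
  have h := (hT _ (J.map π.symm.toEmbedding : Finset _)).preimage
    (measurePreserving_comp_equiv Q π).quasiMeasurePreserving
  convert h using 1
  ext z
  have h2 := mem_traceFinset_comp_equiv (𝒜 := 𝒜) (z := z) π (J := J.map π.symm.toEmbedding)
  have h3 : (J.map π.symm.toEmbedding).map π.toEmbedding = J := by
    ext; simp
  rw [h3] at h2
  exact h2.symm.trans mem_traceFinset

/-- A measurable hull of the event that `J` is a trace of `𝒜` on the points. -/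
noncomputable def traceHull {d : ℕ} (Q : Measure (E d)) (𝒜 : Set (Set (E d))) {ι : Type*}
    [Fintype ι] (J : Finset ι) : Set (ι → E d) :=
  toMeasurable (Measure.pi fun _ => Q) {z | J ∈ traceFinset 𝒜 z}

lemma measurableSet_traceHull {d : ℕ} {Q : Measure (E d)} {𝒜 : Set (Set (E d))} {ι : Type*}
    [Fintype ι] {J : Finset ι} : MeasurableSet (traceHull Q 𝒜 J) :=
  measurableSet_toMeasurable _ _

lemma mem_traceHull {d : ℕ} {Q : Measure (E d)} {𝒜 : Set (Set (E d))} {ι : Type*}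
    [Fintype ι] {J : Finset ι} {z : ι → E d} (h : J ∈ traceFinset 𝒜 z) : z ∈ traceHull Q 𝒜 J :=
  subset_toMeasurable _ {z | J ∈ traceFinset 𝒜 z} h

lemma TraceMeasurable.traceHull_ae_eq {d : ℕ} {Q : Measure (E d)} [IsProbabilityMeasure Q]
    {𝒜 : Set (Set (E d))} (hT : TraceMeasurable Q 𝒜) {ι : Type*} [Fintype ι] (J : Finset ι) :
    traceHull Q 𝒜 J =ᵐ[Measure.pi fun _ => Q] {z | J ∈ traceFinset 𝒜 z} :=
  (hT.nullMeasurableSet J).toMeasurable_ae_eq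

/-- The permutation of a sample and its ghost copy that exchanges the `i`-th points of the two
for every `i` with `s i = true`. -/
def swapPerm {ι : Type*} (s : ι → Bool) : Equiv.Perm (ι ⊕ ι) :=
  Function.Involutive.toPerm
    (Sum.elim (fun i => if s i then .inr i else .inl i) fun i => if s i then .inl i else .inr i)
    (by rintro (i | i) <;> cases h : s i <;> simp [h])

/-- Weight of an index set of the double sample: a factor `l` for every point of the sample and a
factor `r` for every point of the ghost copy. -/
noncomputable def doubleWeight {ι : Type*} (l r : ℝ≥0∞) (J : Finset (ι ⊕ ι)) : ℝ≥0∞ :=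
  l ^ J.toLeft.card * r ^ J.toRight.card

lemma doubleWeight_eq_prod {ι : Type*} [Fintype ι] [DecidableEq ι] (l r : ℝ≥0∞)
    (J : Finset (ι ⊕ ι)) : doubleWeight l r J =
      ∏ i, (if Sum.inl i ∈ J then l else 1) * (if Sum.inr i ∈ J then r else 1) := by
  rw [Finset.prod_mul_distrib, doubleWeight]
  congr 1
  · rw [← Finset.prod_const, ← Finset.prod_subset (Finset.subset_univ J.toLeft)]
    · exact Finset.prod_congr rfl fun i hi => by simp [Finset.mem_toLeft.1 hi]
    · intro i _ hi; simp [mt Finset.mem_toLeft.2 hi]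
  · rw [← Finset.prod_const, ← Finset.prod_subset (Finset.subset_univ J.toRight)]
    · exact Finset.prod_congr rfl fun i hi => by simp [Finset.mem_toRight.1 hi]
    · intro i _ hi; simp [mt Finset.mem_toRight.2 hi]

/-- Averaged over the swaps, the weight of a fixed index set is at most one: each index contributes
`1`, `(l + r) / 2` or `l * r`. -/
lemma sum_doubleWeight_map_swapPerm_le {ι : Type*} [Fintype ι] [DecidableEq ι] {l r : ℝ≥0∞}
    (hadd : l + r ≤ 2) (hmul : l * r ≤ 1) (J : Finset (ι ⊕ ι)) :
    ∑ s : ι → Bool, doubleWeight l r (J.map (swapPerm s).toEmbedding) ≤ 2 ^ Fintype.card ι := by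
  let G : ι → Bool → ℝ≥0∞ := fun i b =>
    (if (if b then Sum.inr i else Sum.inl i) ∈ J then l else 1) *
      (if (if b then Sum.inl i else Sum.inr i) ∈ J then r else 1)
  have hG : ∀ s : ι → Bool,
      doubleWeight l r (J.map (swapPerm s).toEmbedding) = ∏ i, G i (s i) := fun s => by
    rw [doubleWeight_eq_prod]
    refine Finset.prod_congr rfl fun i _ => ?_
    have hl : Sum.inl i ∈ J.map (swapPerm s).toEmbedding
        ↔ (if s i then Sum.inr i else Sum.inl i) ∈ J := by
      rw [Finset.mem_map_equiv]; rfl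
    have hr : Sum.inr i ∈ J.map (swapPerm s).toEmbedding
        ↔ (if s i then Sum.inl i else Sum.inr i) ∈ J := by
      rw [Finset.mem_map_equiv]; rfl
    simp only [hl, hr, G]
  simp_rw [hG]
  rw [← Fintype.prod_sum]
  refine (Finset.prod_le_prod' (g := fun _ => (2 : ℝ≥0∞)) fun i _ => ?_).trans_eq (by simp)
  have h2 : l * r + l * r ≤ 2 := by
    rw [← one_add_one_eq_two]; exact add_le_add hmul hmul
  rw [Fintype.sum_bool]
  by_cases h₁ : Sum.inl i ∈ J <;> by_cases h₂ : Sum.inr i ∈ J <;>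
    simp [G, h₁, h₂, h2, add_comm r l, hadd, one_add_one_eq_two]

lemma sum_traceFinset_eq_sum_ite {T ι : Type*} [Fintype ι] {𝒜 : Set (Set T)} {z : ι → T}
    (w : Finset ι → ℝ≥0∞) : ∑ J ∈ traceFinset 𝒜 z, w J
      = ∑ J, {z | J ∈ traceFinset 𝒜 z}.indicator (fun _ => w J) z := by
  classical
  simp only [Set.indicator_apply, Set.mem_ofPred_eq, Finset.sum_ite_mem, Finset.univ_inter]

lemma TraceMeasurable.aemeasurable_sum {d : ℕ} {Q : Measure (E d)} [IsProbabilityMeasure Q]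
    {𝒜 : Set (Set (E d))} (hT : TraceMeasurable Q 𝒜) {ι : Type*} [Fintype ι]
    (w : Finset ι → ℝ≥0∞) :
    AEMeasurable (fun z : ι → E d => ∑ J ∈ traceFinset 𝒜 z, w J) (Measure.pi fun _ => Q) := by
  simp_rw [sum_traceFinset_eq_sum_ite]
  exact Finset.aemeasurable_fun_sum _ fun J _ =>
    aemeasurable_const.indicator₀ (hT.nullMeasurableSet J)

/-- Symmetrization: the traces of the double sample, weighted by `doubleWeight`, have expected total
weight at most the Sauer–Shelah bound for `2 n` points. -/
lemma lintegral_sum_doubleWeight_le {d v : ℕ} {Q : Measure (E d)} [IsProbabilityMeasure Q]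
    {𝒜 : Set (Set (E d))} (hT : TraceMeasurable Q 𝒜) (hv : vcDim 𝒜 ≤ v) {ι : Type*} [Fintype ι]
    {l r : ℝ≥0∞} (hadd : l + r ≤ 2) (hmul : l * r ≤ 1) :
    ∫⁻ z : ι ⊕ ι → E d, ∑ J ∈ traceFinset 𝒜 z, doubleWeight l r J ∂(Measure.pi fun _ => Q)
      ≤ (2 * Fintype.card ι + 1) ^ v := by
  classical
  set Φ : (ι ⊕ ι → E d) → ℝ≥0∞ := fun z => ∑ J ∈ traceFinset 𝒜 z, doubleWeight l r J with hΦ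
  have hΦm : AEMeasurable Φ (Measure.pi fun _ => Q) := hT.aemeasurable_sum _
  have hmp := fun s : ι → Bool => measurePreserving_comp_equiv Q (swapPerm s)
  have hinv : ∀ s : ι → Bool, ∫⁻ z, Φ (z ∘ swapPerm s) ∂(Measure.pi fun _ => Q)
      = ∫⁻ z, Φ z ∂(Measure.pi fun _ => Q) := fun s => by
    conv_rhs => rw [← (hmp s).map_eq]
    exact (lintegral_map' ((hmp s).map_eq.symm ▸ hΦm) (hmp s).measurable.aemeasurable).symm
  have hswap : ∀ (s : ι → Bool) (z : ι ⊕ ι → E d), Φ (z ∘ swapPerm s)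
      = ∑ J ∈ traceFinset 𝒜 z, doubleWeight l r (J.map (swapPerm s).toEmbedding) := fun s z => by
    have hss : ∀ J : Finset (ι ⊕ ι),
        (J.map (swapPerm s).toEmbedding).map (swapPerm s).toEmbedding = J := fun J => by
      ext j; rw [Finset.mem_map_equiv, Finset.mem_map_equiv]
      have hj : (swapPerm s).symm ((swapPerm s).symm j) = j := (swapPerm s).symm_apply_apply j
      rw [hj]
    refine Finset.sum_nbij' (fun J => J.map (swapPerm s).toEmbedding)
      (fun J => J.map (swapPerm s).toEmbedding)
      (fun J hJ => (mem_traceFinset_comp_equiv _).1 hJ)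
      (fun J hJ => (mem_traceFinset_comp_equiv _).2 (by rwa [hss]))
      (fun J _ => hss J) (fun J _ => hss J) (fun J _ => by rw [hss])
  have hbound : ∀ z : ι ⊕ ι → E d, ∑ s : ι → Bool, Φ (z ∘ swapPerm s)
      ≤ 2 ^ Fintype.card ι * (2 * Fintype.card ι + 1) ^ v := fun z => by
    simp_rw [hswap]
    rw [Finset.sum_comm]
    refine (Finset.sum_le_card_nsmul _ _ _ fun J _ =>
      sum_doubleWeight_map_swapPerm_le hadd hmul J).trans ?_
    rw [nsmul_eq_mul, mul_comm]
    gcongr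
    have := card_traceFinset_le hv z
    rw [Fintype.card_sum, ← two_mul] at this
    exact_mod_cast this
  have hsum : 2 ^ Fintype.card ι * ∫⁻ z, Φ z ∂(Measure.pi fun _ => Q)
      ≤ 2 ^ Fintype.card ι * (2 * Fintype.card ι + 1) ^ v := by
    calc 2 ^ Fintype.card ι * ∫⁻ z, Φ z ∂(Measure.pi fun _ => Q)
        = ∑ s : ι → Bool, ∫⁻ z, Φ (z ∘ swapPerm s) ∂(Measure.pi fun _ => Q) := by
          simp [hinv]
      _ = ∫⁻ z, ∑ s : ι → Bool, Φ (z ∘ swapPerm s) ∂(Measure.pi fun _ => Q) :=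
          (lintegral_finsetSum' _ fun s _ => hΦm.comp_quasiMeasurePreserving
            (hmp s).quasiMeasurePreserving).symm
      _ ≤ ∫⁻ _, 2 ^ Fintype.card ι * (2 * Fintype.card ι + 1) ^ v ∂(Measure.pi fun _ => Q) :=
          lintegral_mono hbound
      _ = _ := by simp
  exact (ENNReal.mul_le_mul_iff_right (by simp) (by simp)).1 hsum

open Classical in
/-- Indices of the sample points whose covariate lies in `A`. -/
noncomputable def indexSet {X Y ι : Type*} [Fintype ι] (z : ι → X × Y) (A : Set X) : Finset ι :=
  {i | (z i).1 ∈ A}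

lemma coe_indexSet {X Y ι : Type*} [Fintype ι] (z : ι → X × Y) (A : Set X) :
    (indexSet z A : Set ι) = (fun i => (z i).1) ⁻¹' A := by
  ext; simp [indexSet]

lemma indexSet_mem_traceFinset {X Y ι : Type*} [Fintype ι] {𝒜 : Set (Set X)} {A : Set X}
    (hA : A ∈ 𝒜) (z : ι → X × Y) : indexSet z A ∈ traceFinset 𝒜 fun i => (z i).1 :=
  mem_traceFinset.2 ⟨A, hA, (coe_indexSet z A).symm⟩

/-- Jensen's inequality for the moment generating function of the indicator of `A`. -/
lemma exp_mul_le_lintegral_ite {X : Type*} [MeasurableSpace X] (Q : Measure X)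
    [IsProbabilityMeasure Q] {A : Set X} (hA : MeasurableSet A) [DecidablePred (· ∈ A)] (lam : ℝ) :
    ENNReal.ofReal (Real.exp (lam * Q.real A))
      ≤ ∫⁻ x, (if x ∈ A then ENNReal.ofReal (Real.exp lam) else 1) ∂Q := by
  have h1 : ∫⁻ x, (if x ∈ A then ENNReal.ofReal (Real.exp lam) else 1) ∂Q
      = ENNReal.ofReal (Real.exp lam) * Q A + Q Aᶜ := by
    rw [← lintegral_add_compl _ hA, setLIntegral_congr_fun hA
      (g := fun _ => ENNReal.ofReal (Real.exp lam)) (fun x hx => by simp [hx]),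
      setLIntegral_congr_fun hA.compl (g := fun _ => 1) (fun x hx => if_neg hx)]
    simp
  have h2 : Real.exp (lam * Q.real A) ≤ Real.exp lam * Q.real A + (1 - Q.real A) := by
    have := convexOn_exp.2 (Set.mem_univ lam) (Set.mem_univ 0)
      (measureReal_nonneg (μ := Q) (s := A))
      (sub_nonneg.2 (measureReal_le_one (μ := Q) (s := A))) (by ring)
    simpa [mul_comm] using this
  rw [h1, ← ofReal_measureReal (μ := Q) (s := A), ← ofReal_measureReal (μ := Q) (s := Aᶜ),
    ← ENNReal.ofReal_mul (Real.exp_pos _).le, ← ENNReal.ofReal_add (by positivity) (by positivity),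
    probReal_compl_eq_one_sub hA]
  exact ENNReal.ofReal_le_ofReal h2

/-- Total weight of the double-sample index sets that extend `J`, averaged over the ghost sample
(the trace events are replaced by measurable hulls). -/
noncomputable def ghostWeight {d : ℕ} (Q : Measure (E d)) (𝒜 : Set (Set (E d))) {ι : Type*}
    [Fintype ι] [DecidableEq ι] (l r : ℝ≥0∞) (J : Finset ι) (x : ι → E d) : ℝ≥0∞ :=
  ∫⁻ x' : ι → E d, ∑ T : Finset (ι ⊕ ι), (if T.toLeft = J then
    (traceHull Q 𝒜 T).indicator
      (fun _ => doubleWeight l r T) (Sum.elim x x') else 0) ∂(Measure.pi fun _ => Q)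

section ghostWeight

variable {d : ℕ} {Q : Measure (E d)} {𝒜 : Set (Set (E d))} {ι : Type*}
  [Fintype ι] [DecidableEq ι] {l r : ℝ≥0∞}

lemma measurable_ghostWeight_integrand (J : Finset ι) :
    Measurable fun p : (ι → E d) × (ι → E d) => ∑ T : Finset (ι ⊕ ι), (if T.toLeft = J then
      (traceHull Q 𝒜 T).indicator
        (fun _ => doubleWeight l r T) (Sum.elim p.1 p.2) else 0) := by
  refine Finset.measurable_fun_sum _ fun T _ => ?_
  split_ifs
  · exact (measurable_const.indicator measurableSet_traceHull).comp
      (MeasurableEquiv.sumPiEquivProdPi fun _ : ι ⊕ ι => E d).symm.measurable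
  · exact measurable_const

variable [IsProbabilityMeasure Q]

lemma measurable_ghostWeight (J : Finset ι) : Measurable (ghostWeight Q 𝒜 l r J) :=
  (measurable_ghostWeight_integrand J).lintegral_prod_right'

lemma sum_lintegral_ghostWeight_le {v : ℕ} (hT : TraceMeasurable Q 𝒜) (hv : vcDim 𝒜 ≤ v)
    (hadd : l + r ≤ 2) (hmul : l * r ≤ 1) :
    ∑ J, ∫⁻ x, ghostWeight Q 𝒜 l r J x ∂(Measure.pi fun _ : ι => Q)
      ≤ (2 * Fintype.card ι + 1) ^ v := by
  refine le_trans (le_of_eq ?_) (lintegral_sum_doubleWeight_le hT hv (ι := ι) hadd hmul)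
  let F : (ι ⊕ ι → E d) → ℝ≥0∞ := fun z => ∑ T : Finset (ι ⊕ ι),
    (traceHull Q 𝒜 T).indicator
      (fun _ => doubleWeight l r T) z
  have hF : Measurable F := Finset.measurable_fun_sum _ fun T _ =>
    measurable_const.indicator measurableSet_traceHull
  have hFeq : ∫⁻ z, ∑ J ∈ traceFinset 𝒜 z, doubleWeight l r J ∂(Measure.pi fun _ : ι ⊕ ι => Q)
      = ∫⁻ z, F z ∂(Measure.pi fun _ : ι ⊕ ι => Q) := by
    refine lintegral_congr_ae ?_
    have : ∀ᵐ z ∂(Measure.pi fun _ : ι ⊕ ι => Q), ∀ T : Finset (ι ⊕ ι),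
        (traceHull Q 𝒜 T).indicator
          (fun _ => doubleWeight l r T) z
        = {z | T ∈ traceFinset 𝒜 z}.indicator (fun _ => doubleWeight l r T) z :=
      ae_all_iff.2 fun T =>
        indicator_ae_eq_of_ae_eq_set (hT.traceHull_ae_eq T)
    filter_upwards [this] with z hz
    rw [sum_traceFinset_eq_sum_ite]
    exact Finset.sum_congr rfl fun T _ => (hz T).symm
  rw [hFeq, ← (measurePreserving_sumPiEquivProdPi_symm fun _ : ι ⊕ ι => Q).lintegral_comp hF,
    lintegral_prod (fun p => F ((MeasurableEquiv.sumPiEquivProdPi fun _ => E d).symm p))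
      (hF.comp (MeasurableEquiv.measurable _)).aemeasurable,
    ← lintegral_finsetSum _ fun J _ => measurable_ghostWeight J]
  refine lintegral_congr fun x => ?_
  simp only [ghostWeight]
  refine (lintegral_finsetSum _ fun J _ => (measurable_ghostWeight_integrand J).comp
    measurable_prodMk_left).symm.trans (lintegral_congr fun x' => ?_)
  simp only [Function.comp_apply]
  rw [Finset.sum_comm]
  simp only [Finset.sum_ite_eq, Finset.mem_univ, if_true]
  rfl

/-- Jensen's inequality for the ghost sample: the trace of `A` alone contributes at least
`exp (lam n Q(A))`, whatever the sample. -/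
lemma le_ghostWeight {Y : Type*} {A : Set (E d)} (hA : A ∈ 𝒜) (hAm : MeasurableSet A) (lam : ℝ)
    (z : ι → E d × Y) :
    l ^ (indexSet z A).card * ENNReal.ofReal (Real.exp (lam * (Fintype.card ι * Q.real A)))
      ≤ ghostWeight Q 𝒜 l (ENNReal.ofReal (Real.exp lam)) (indexSet z A) fun i => (z i).1 := by
  classical
  set r := ENNReal.ofReal (Real.exp lam)
  have hf : Measurable fun x : E d => if x ∈ A then r else 1 :=
    Measurable.ite hAm measurable_const measurable_const
  calc l ^ (indexSet z A).card * ENNReal.ofReal (Real.exp (lam * (Fintype.card ι * Q.real A)))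
      = l ^ (indexSet z A).card * ∏ _i : ι, ENNReal.ofReal (Real.exp (lam * Q.real A)) := by
        rw [Finset.prod_const, ← ENNReal.ofReal_pow (Real.exp_pos _).le, ← Real.exp_nat_mul,
          Finset.card_univ]
        rw [mul_left_comm]
    _ ≤ l ^ (indexSet z A).card * ∏ _i : ι, ∫⁻ x, (if x ∈ A then r else 1) ∂Q := by
        gcongr
        exact exp_mul_le_lintegral_ite Q hAm lam
    _ = ∫⁻ x' : ι → E d, l ^ (indexSet z A).card * ∏ i, (if x' i ∈ A then r else 1)
          ∂(Measure.pi fun _ => Q) := by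
        have hfi : ∀ i, Measurable fun x' : ι → E d => if x' i ∈ A then r else 1 := fun i =>
          hf.comp (measurable_pi_apply i)
        rw [lintegral_const_mul _ (Finset.measurable_fun_prod _ fun i _ => hfi i),
          lintegral_prod_eq_prod_lintegral_of_indepFun Finset.univ
          (fun i (x' : ι → E d) => if x' i ∈ A then r else 1)
          (iIndepFun_pi (X := fun _ x => if x ∈ A then r else 1) fun i => hf.aemeasurable)
          hfi]
        congr 1
        exact Finset.prod_congr rfl fun i _ =>
          ((measurePreserving_eval (fun _ : ι => Q) i).lintegral_comp hf).symm
    _ ≤ _ := by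
        refine lintegral_mono fun x' => ?_
        let w : ι ⊕ ι → E d := Sum.elim (fun i => (z i).1) x'
        let T : Finset (ι ⊕ ι) := Finset.univ.filter fun j => w j ∈ A
        have hTl : T.toLeft = indexSet z A := by
          ext i; simp [T, w, indexSet, Finset.mem_toLeft]
        have hTr : T.toRight = Finset.univ.filter fun i => x' i ∈ A := by
          ext i; simp [T, w, Finset.mem_toRight]
        have hmem : T ∈ traceFinset 𝒜 w := mem_traceFinset.2 ⟨A, hA, by ext; simp [T]⟩
        refine le_trans (le_of_eq ?_) (Finset.single_le_sum (fun _ _ => zero_le)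
          (Finset.mem_univ T))
        rw [if_pos hTl, Set.indicator_of_mem (mem_traceHull hmem), doubleWeight, hTl, hTr,
          Finset.prod_ite]
        simp

end ghostWeight

/-- A one-sided relative deviation bound, uniform over a VC class, in which the masses `n P^X(A)`,
the counts and the noise sums of the sets `A` enter the exponent jointly. The condition on `lam` and
`θ` makes every swap of a sample point with its ghost copy cost at most a factor one on average. -/
theorem measure_exists_mass_count_noise_le {d v : ℕ} {P : Measure (E d × ℝ)}
    [IsProbabilityMeasure P] {𝒜 : Set (Set (E d))} (hT : TraceMeasurable P.fst 𝒜)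
    (hv : vcDim 𝒜 ≤ v) {e : E d × ℝ → ℝ} {σ : ℝ} (h : IsSubGaussianGiven P e σ)
    {ι : Type*} [Fintype ι] {lam θ : ℝ} (hlam : Real.exp (-θ) + Real.exp lam ≤ 2) (t κ : ℝ) :
    (Measure.pi fun _ : ι => P) {z | ∃ A ∈ 𝒜, MeasurableSet A ∧
        κ ≤ lam * (Fintype.card ι * P.fst.real A) - θ * (indexSet z A).card
          + (t * |∑ i ∈ indexSet z A, e (z i)| - σ ^ 2 * t ^ 2 / 2 * (indexSet z A).card)}
      ≤ ENNReal.ofReal (Real.exp (-κ) * (2 * (2 * Fintype.card ι + 1) ^ v)) := by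
  classical
  have hadd : ENNReal.ofReal (Real.exp (-θ)) + ENNReal.ofReal (Real.exp lam) ≤ 2 := by
    rw [← ENNReal.ofReal_add (Real.exp_pos _).le (Real.exp_pos _).le,
      show (2 : ℝ≥0∞) = ENNReal.ofReal 2 by simp]
    exact ENNReal.ofReal_le_ofReal hlam
  have hmul : ENNReal.ofReal (Real.exp (-θ)) * ENNReal.ofReal (Real.exp lam) ≤ 1 := by
    rw [← ENNReal.ofReal_mul (Real.exp_pos _).le, ← ENNReal.ofReal_one]
    refine ENNReal.ofReal_le_ofReal ?_
    nlinarith [Real.exp_pos (-θ), Real.exp_pos lam, sq_nonneg (Real.exp (-θ) - Real.exp lam)]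
  refine (h.measure_le_of_exists (C := ghostWeight P.fst 𝒜 (ENNReal.ofReal (Real.exp (-θ)))
    (ENNReal.ofReal (Real.exp lam))) measurable_ghostWeight (fun _ => t) κ ?_).trans ?_
  · rintro z ⟨A, hA, hAm, hκ⟩
    refine ⟨indexSet z A, le_trans ?_ (mul_le_mul_left (le_ghostWeight hA hAm lam z) _)⟩
    rw [← ENNReal.ofReal_pow (Real.exp_pos _).le, ← Real.exp_nat_mul,
      ← ENNReal.ofReal_mul (Real.exp_pos _).le, ← Real.exp_add,
      ← ENNReal.ofReal_mul (Real.exp_pos _).le, ← Real.exp_add]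
    refine ENNReal.ofReal_le_ofReal (Real.exp_le_exp.2 (hκ.trans (le_of_eq ?_)))
    ring
  · rw [ENNReal.ofReal_mul (Real.exp_pos _).le]
    gcongr
    refine (mul_le_mul_right (sum_lintegral_ghostWeight_le hT hv hadd hmul) 2).trans_eq ?_
    rw [ENNReal.ofReal_mul (by norm_num), ENNReal.ofReal_pow (by positivity),
      ENNReal.ofReal_add (by positivity) (by norm_num), ENNReal.ofReal_mul (by norm_num)]
    simp

/-- Uniform bound on the noise sums over the sets of a VC class that contain a sample point. -/
theorem measure_exists_noise_le {d v : ℕ} {P : Measure (E d × ℝ)}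
    [IsProbabilityMeasure P] {𝒜 : Set (Set (E d))} (hT : TraceMeasurable P.fst 𝒜)
    (hv : vcDim 𝒜 ≤ v) {e : E d × ℝ → ℝ} {σ : ℝ} (h : IsSubGaussianGiven P e σ) (hσ : 0 < σ)
    {ι : Type*} [Fintype ι] {a : ℝ} (ha : 0 ≤ a) :
    (Measure.pi fun _ : ι => P) {z | ∃ A ∈ 𝒜, 0 < (indexSet z A).card ∧
        √(2 * σ ^ 2 * a * (indexSet z A).card) ≤ |∑ i ∈ indexSet z A, e (z i)|}
      ≤ ENNReal.ofReal (Real.exp (-a) * (2 * (Fintype.card ι + 1) ^ v)) := by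
  classical
  refine (h.measure_le_of_exists (C := fun J x =>
    (traceHull P.fst 𝒜 J).indicator 1 x)
    (fun J => measurable_const.indicator measurableSet_traceHull)
    (fun J => √(2 * a / (σ ^ 2 * J.card))) a ?_).trans ?_
  · rintro z ⟨A, hA, hpos, hz⟩
    set J := indexSet z A
    refine ⟨J, ?_⟩
    rw [Set.indicator_of_mem (mem_traceHull (indexSet_mem_traceFinset hA z)),
      Pi.one_apply, one_mul]
    refine ENNReal.ofReal_le_ofReal (Real.exp_le_exp.2 ?_)
    have hJ : (0 : ℝ) < J.card := by exact_mod_cast hpos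
    have h1 : √(2 * a / (σ ^ 2 * J.card)) * √(2 * σ ^ 2 * a * J.card) = 2 * a := by
      rw [← Real.sqrt_mul (by positivity), show 2 * a / (σ ^ 2 * J.card) * (2 * σ ^ 2 * a * J.card)
        = (2 * a) ^ 2 by field_simp]
      exact Real.sqrt_sq (by positivity)
    have h2 : σ ^ 2 * √(2 * a / (σ ^ 2 * J.card)) ^ 2 / 2 * J.card = a := by
      rw [Real.sq_sqrt (by positivity)]; field_simp
    have h3 := mul_le_mul_of_nonneg_left hz (Real.sqrt_nonneg (2 * a / (σ ^ 2 * J.card)))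
    rw [h1] at h3
    rw [h2]; linarith
  · rw [ENNReal.ofReal_mul (Real.exp_pos _).le]
    gcongr
    rw [ENNReal.ofReal_mul (by norm_num), ENNReal.ofReal_ofNat]
    gcongr
    calc ∑ J, ∫⁻ x, (traceHull P.fst 𝒜 J).indicator 1 x ∂(Measure.pi fun _ : ι => P.fst)
        = ∑ J, ∫⁻ x, {x : ι → E d | J ∈ traceFinset 𝒜 x}.indicator (fun _ => 1) x
            ∂(Measure.pi fun _ : ι => P.fst) := Finset.sum_congr rfl fun J _ =>
          lintegral_congr_ae
            (indicator_ae_eq_of_ae_eq_set (hT.traceHull_ae_eq J))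
      _ = ∫⁻ x, ∑ J ∈ traceFinset 𝒜 x, 1 ∂(Measure.pi fun _ : ι => P.fst) := by
          simp_rw [sum_traceFinset_eq_sum_ite]
          exact (lintegral_finsetSum' _ fun J _ =>
            aemeasurable_const.indicator₀ (hT.nullMeasurableSet J)).symm
      _ ≤ ∫⁻ _, ENNReal.ofReal ((Fintype.card ι + 1) ^ v) ∂(Measure.pi fun _ : ι => P.fst) := by
          refine lintegral_mono fun x => ?_
          have := card_traceFinset_le hv x
          simp only [Finset.sum_const, nsmul_eq_mul, mul_one]
          rw [← ENNReal.ofReal_natCast]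
          exact ENNReal.ofReal_le_ofReal (by exact_mod_cast this)
      _ = _ := by simp

/-! ### Exponents and constants -/

/-- Exponent gained per unit of mass when the count is at most two thirds of the mass. -/
lemma one_div_thirty_le_log_sub : (1 : ℝ) / 30 ≤ Real.log (6 / 5) - 2 / 3 * Real.log (5 / 4) := by
  have h1 : 3 * Real.log (6 / 5) - 2 * Real.log (5 / 4) = Real.log (3456 / 3125) := by
    rw [show (3456 / 3125 : ℝ) = (6 / 5) ^ 3 / (5 / 4) ^ 2 by norm_num,
      Real.log_div (x := (6 / 5) ^ 3) (by norm_num) (by norm_num), Real.log_pow, Real.log_pow]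
    norm_num
  have h2 : (1 : ℝ) / 10 ≤ Real.log (3456 / 3125) := by
    rw [Real.le_log_iff_exp_le (by norm_num)]
    refine le_of_pow_le_pow_left₀ (n := 10) (by norm_num) (by norm_num) ?_
    rw [← Real.exp_nat_mul]
    norm_num
    exact Real.exp_one_lt_d9.le.trans (by norm_num)
  linarith

lemma one_div_six_le_log : (1 : ℝ) / 6 ≤ Real.log (6 / 5) := by
  have := Real.one_sub_inv_le_log_of_pos (x := 6 / 5) (by norm_num)
  linarith

/-- Masses from `8 b` to `40 b`: a deficient count and a large noise sum together are worth the
exponent `a + b / 4`. The value is affine in the count `N`, so the cases `N = 0` and `N = 2 q / 3`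
suffice; `t` is tuned to the mass `q = 10 b`. -/
lemma add_div_four_le_exponent {a b q N M σ : ℝ} (hσ : 0 < σ) (ha : 0 < a) (hab : a ≤ b)
    (hq : 8 * b ≤ q) (hq' : q ≤ 40 * b) (hN : 0 ≤ N) (hNq : N ≤ 2 / 3 * q)
    (hM : N * √(3 * σ ^ 2 * a / q) ≤ M) :
    a + b / 4 ≤ Real.log (6 / 5) * q - Real.log (5 / 4) * N
      + (√(3 * a / (10 * b)) / σ * M - σ ^ 2 * (√(3 * a / (10 * b)) / σ) ^ 2 / 2 * N) := by
  have hb : 0 < b := ha.trans_le hab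
  have hq0 : 0 < q := by linarith
  obtain ⟨y, hy0, hyq⟩ : ∃ y : ℝ, 0 < y ∧ q = 10 * b * y ^ 2 :=
    ⟨√(q / (10 * b)), by positivity, by rw [Real.sq_sqrt (by positivity)]; field_simp⟩
  have hy1 : 89 / 100 ≤ y := by
    by_contra! h
    have : y ^ 2 < 4 / 5 := by nlinarith
    nlinarith
  have hy2 : y ≤ 2 := by
    by_contra! h
    have : 4 < y ^ 2 := by nlinarith
    nlinarith
  have ht : √(3 * a / (10 * b)) / σ * √(3 * σ ^ 2 * a / q) = 3 * a * y / q := by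
    have h1 : √(3 * σ ^ 2 * a / q) = √(3 * a / (10 * b)) * (σ / y) := by
      rw [show 3 * σ ^ 2 * a / q = 3 * a / (10 * b) * (σ / y) ^ 2 by rw [hyq]; field_simp,
        Real.sqrt_mul (by positivity), Real.sqrt_sq (by positivity)]
    rw [h1]
    calc _ = √(3 * a / (10 * b)) ^ 2 / y := by field_simp
      _ = _ := by rw [Real.sq_sqrt (by positivity), hyq]; field_simp
  have ht2 : σ ^ 2 * (√(3 * a / (10 * b)) / σ) ^ 2 / 2 = 3 * a * y ^ 2 / (2 * q) := by
    rw [div_pow, Real.sq_sqrt (by positivity), hyq]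
    field_simp
  have hM' : N * (3 * a * y / q) ≤ √(3 * a / (10 * b)) / σ * M := by
    rw [← ht]
    calc _ = √(3 * a / (10 * b)) / σ * (N * √(3 * σ ^ 2 * a / q)) := by ring
      _ ≤ _ := by gcongr
  rw [ht2]
  obtain ⟨s, hs⟩ : ∃ s : ℝ, N = s * q := ⟨N / q, by field_simp⟩
  have hs0 : 0 ≤ s := by
    by_contra! h; nlinarith
  have hs1 : s ≤ 2 / 3 := by
    by_contra! h; nlinarith
  have hval : N * (3 * a * y / q) - 3 * a * y ^ 2 / (2 * q) * N
      = 3 / 2 * s * (a * (2 * y - y ^ 2)) := by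
    rw [hs]; field_simp
  have h0 : a + b / 4 ≤ Real.log (6 / 5) * q := by
    nlinarith [one_div_six_le_log]
  have h1 : a + b / 4 ≤ (Real.log (6 / 5) - 2 / 3 * Real.log (5 / 4)) * q
      + a * (2 * y - y ^ 2) := by
    have h2 : 1 / 30 * q ≤ (Real.log (6 / 5) - 2 / 3 * Real.log (5 / 4)) * q := by
      gcongr; exact one_div_thirty_le_log_sub
    have h3 : (y - 1) ^ 2 + 1 / 4 ≤ y ^ 2 / 3 := by nlinarith
    have h4 : a * (y - 1) ^ 2 ≤ b * (y - 1) ^ 2 := by gcongr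
    have h5 := mul_le_mul_of_nonneg_left h3 hb.le
    nlinarith
  have h6 := mul_le_mul_of_nonneg_left h0 (show 0 ≤ 1 - 3 / 2 * s by linarith)
  have h7 := mul_le_mul_of_nonneg_left h1 (show 0 ≤ 3 / 2 * s by linarith)
  have h8 : Real.log (5 / 4) * N = 3 / 2 * s * (2 / 3 * Real.log (5 / 4) * q) := by rw [hs]; ring
  nlinarith

/-- For masses beyond `40 b` a deficient count alone is worth the exponent `4 b / 3`. -/
lemma four_thirds_mul_le_exponent {b q N : ℝ} (hb : 0 < b) (hq : 40 * b ≤ q)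
    (hNq : N ≤ 2 / 3 * q) :
    4 / 3 * b ≤ Real.log (6 / 5) * q - Real.log (5 / 4) * N := by
  have h1 : Real.log (5 / 4) * N ≤ Real.log (5 / 4) * (2 / 3 * q) :=
    mul_le_mul_of_nonneg_left hNq (Real.log_nonneg (by norm_num))
  have h2 : 1 / 30 * q ≤ (Real.log (6 / 5) - 2 / 3 * Real.log (5 / 4)) * q := by
    have : 0 ≤ q := by linarith
    gcongr; exact one_div_thirty_le_log_sub
  linarith

/-- The two exponents beat the double-sample union bound. A set of mass `8 b` can exist only if
`8 b ≤ n`, which forces `n ≥ 29`; this leaves enough room for the constants. -/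
lemma deviation_budget_le {n v : ℕ} (hn : 1 ≤ n) (hv : 0 < v) {δ a b : ℝ} (hδ0 : 0 < δ)
    (hδ1 : δ < 1 / 3) (ha : a = Real.log (((n : ℝ) + 1) ^ v / δ))
    (hb : b = Real.log (4 * (2 * (n : ℝ) + 1) ^ v / δ)) (hnb : 8 * b ≤ n) :
    Real.exp (-(a + b / 4)) * (2 * (2 * (n : ℝ) + 1) ^ v)
      + Real.exp (-(4 / 3 * b)) * (2 * (2 * (n : ℝ) + 1) ^ v) ≤ δ := by
  have hn' : (1 : ℝ) ≤ n := by exact_mod_cast hn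
  set K : ℝ := ((n : ℝ) + 1) ^ v with hK
  set K2 : ℝ := (2 * (n : ℝ) + 1) ^ v with hK2
  have hK0 : 0 < K := by positivity
  have hK20 : 0 < K2 := by positivity
  have hpow : ∀ m : ℝ, 1 ≤ m → m ≤ 2 * n + 1 → m ≤ K2 := fun m hm hmn =>
    hmn.trans (le_self_pow₀ (by linarith) hv.ne')
  have hb1 : 7 / 2 < b := by
    have h36 : 36 < 4 * K2 / δ := by
      rw [lt_div_iff₀ hδ0]
      have := hpow 3 (by norm_num) (by linarith)
      linarith
    rw [hb, Real.lt_log_iff_exp_lt (by positivity)]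
    refine lt_trans ?_ h36
    refine lt_of_pow_lt_pow_left₀ 2 (by norm_num) ?_
    rw [← Real.exp_nat_mul, show ((2 : ℕ) : ℝ) * (7 / 2) = (7 : ℕ) * 1 by norm_num,
      Real.exp_nat_mul]
    calc Real.exp 1 ^ 7 < 2.7182818286 ^ 7 := by gcongr; exact Real.exp_one_lt_d9
      _ < 36 ^ 2 := by norm_num
  have hn29 : (29 : ℝ) ≤ n := by
    have : (28 : ℝ) < n := by linarith
    exact_mod_cast this
  have hea : Real.exp (-a) = δ / K := by
    rw [ha, Real.exp_neg, Real.exp_log (by positivity), inv_div]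
  have heb : Real.exp (-b) = δ / (4 * K2) := by
    rw [hb, Real.exp_neg, Real.exp_log (by positivity), inv_div]
  have hratio : K2 ≤ 2 ^ v * K := by
    rw [hK, hK2, ← mul_pow]; gcongr; linarith
  have hfirst : Real.exp (-(a + b / 4)) * (2 * K2) ≤ 4 / 5 * δ := by
    have hx : 2 * 2 ^ v * Real.exp (-(b / 4)) ≤ 4 / 5 := by
      refine le_of_pow_le_pow_left₀ (n := 4) (by norm_num) (by norm_num) ?_
      rw [mul_pow, ← Real.exp_nat_mul, show ((4 : ℕ) : ℝ) * (-(b / 4)) = -b by push_cast; ring, heb]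
      have h59 : (16 / 59 : ℝ) ^ v ≤ 16 / 59 := pow_le_of_le_one (by norm_num) (by norm_num) hv.ne'
      have h16 : (2 * 2 ^ v : ℝ) ^ 4 = 16 * 16 ^ v := by
        rw [mul_pow, ← pow_mul, mul_comm v 4, pow_mul]; norm_num
      have hK59 : (59 : ℝ) ^ v ≤ K2 := by rw [hK2]; gcongr; linarith
      calc (2 * 2 ^ v : ℝ) ^ 4 * (δ / (4 * K2)) ≤ 16 * 16 ^ v * ((1 / 3) / (4 * 59 ^ v)) := by
            rw [h16]; gcongr
        _ = 4 / 3 * (16 / 59) ^ v := by rw [div_pow]; field_simp; norm_num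
        _ ≤ 4 / 3 * (16 / 59) := by gcongr
        _ ≤ _ := by norm_num
    rw [neg_add, Real.exp_add, hea]
    calc δ / K * Real.exp (-(b / 4)) * (2 * K2)
        ≤ δ / K * Real.exp (-(b / 4)) * (2 * (2 ^ v * K)) := by gcongr
      _ = δ * (2 * 2 ^ v * Real.exp (-(b / 4))) := by field_simp
      _ ≤ δ * (4 / 5) := by gcongr
      _ = _ := by ring
  have hsecond : Real.exp (-(4 / 3 * b)) * (2 * K2) ≤ 1 / 5 * δ := by
    have h1 : Real.exp (-(b / 3)) ≤ 2 / 5 := by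
      calc Real.exp (-(b / 3)) ≤ Real.exp (-1) := Real.exp_le_exp.2 (by linarith)
        _ ≤ 2 / 5 := by
          rw [Real.exp_neg, inv_le_comm₀ (Real.exp_pos _) (by norm_num)]
          exact le_trans (by norm_num) Real.exp_one_gt_d9.le
    rw [show -(4 / 3 * b) = -b + -(b / 3) by ring, Real.exp_add, heb]
    calc δ / (4 * K2) * Real.exp (-(b / 3)) * (2 * K2) = δ / 2 * Real.exp (-(b / 3)) := by
          field_simp; norm_num
      _ ≤ δ / 2 * (2 / 5) := by gcongr
      _ = _ := by ring
  linarith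

/-! ### The bad event -/

/-- The samples for which the noise average over some large enough set `A` of the class exceeds its
bound (or is undefined, `A` containing no sample point). The mass `n P^X(A)` enters, not the
count. The comparison is strict: with `≤` the event would be far too large when `σ = 0`. -/
def badSamples {d n : ℕ} (P : Measure (E d × ℝ)) (𝒜 : Set (Set (E d))) (e : E d × ℝ → ℝ)
    (σ a b : ℝ) : Set (Fin n → E d × ℝ) :=
  {z | ∃ A ∈ 𝒜, MeasurableSet A ∧ 0 < n * P.fst.real A ∧
    8 * b ≤ max ((indexSet z A).card : ℝ) (n * P.fst.real A) ∧
    ((indexSet z A).card = 0 ∨ (indexSet z A).card * √(3 * σ ^ 2 * a / (n * P.fst.real A))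
      < |∑ i ∈ indexSet z A, e (z i)|)}

lemma measure_badSamples_le_of_pos {d n v : ℕ} (hn : 1 ≤ n) (hv : 0 < v) {δ : ℝ} (hδ0 : 0 < δ)
    (hδ1 : δ < 1 / 3) {P : Measure (E d × ℝ)} [IsProbabilityMeasure P] {𝒜 : Set (Set (E d))}
    (hT : TraceMeasurable P.fst 𝒜) (hvc : vcDim 𝒜 ≤ v) {e : E d × ℝ → ℝ} {σ : ℝ}
    (h : IsSubGaussianGiven P e σ) (hσ : 0 < σ) :
    (Measure.pi fun _ : Fin n => P) (badSamples P 𝒜 e σ (Real.log (((n : ℝ) + 1) ^ v / δ))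
      (Real.log (4 * (2 * (n : ℝ) + 1) ^ v / δ))) ≤ ENNReal.ofReal (3 * δ) := by
  set a := Real.log (((n : ℝ) + 1) ^ v / δ) with ha
  set b := Real.log (4 * (2 * (n : ℝ) + 1) ^ v / δ) with hb
  have hn0 : (0 : ℝ) < n := by exact_mod_cast hn
  have ha0 : 0 < a := by
    refine Real.log_pos ?_
    rw [lt_div_iff₀ hδ0]
    have : (1 : ℝ) ≤ (n + 1) ^ v := one_le_pow₀ (by linarith)
    linarith
  have hab : a ≤ b := by
    refine Real.log_le_log (by positivity) ?_
    have h1 : ((n : ℝ) + 1) ^ v ≤ (2 * n + 1) ^ v := by gcongr; linarith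
    have h2 : (0 : ℝ) ≤ (2 * n + 1) ^ v := by positivity
    gcongr
    linarith
  have hlam : Real.exp (-Real.log (5 / 4)) + Real.exp (Real.log (6 / 5)) ≤ 2 := by
    rw [Real.exp_neg, Real.exp_log (by norm_num), Real.exp_log (by norm_num)]; norm_num
  set F1 : Set (Fin n → E d × ℝ) := {z | ∃ A ∈ 𝒜, 0 < (indexSet z A).card ∧
    √(2 * σ ^ 2 * a * (indexSet z A).card) ≤ |∑ i ∈ indexSet z A, e (z i)|} with hF1
  set F : ℝ → ℝ → Set (Fin n → E d × ℝ) := fun t κ => {z | ∃ A ∈ 𝒜, MeasurableSet A ∧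
    κ ≤ Real.log (6 / 5) * (n * P.fst.real A) - Real.log (5 / 4) * (indexSet z A).card
      + (t * |∑ i ∈ indexSet z A, e (z i)| - σ ^ 2 * t ^ 2 / 2 * (indexSet z A).card)} with hF
  have hP1 : (Measure.pi fun _ : Fin n => P) F1 ≤ ENNReal.ofReal (2 * δ) := by
    refine (measure_exists_noise_le hT hvc h hσ ha0.le).trans_eq ?_
    rw [Fintype.card_fin, ha, Real.exp_neg, Real.exp_log (by positivity)]
    congr 1
    field_simp
  have hPF : ∀ t κ, (Measure.pi fun _ : Fin n => P) (F t κ)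
      ≤ ENNReal.ofReal (Real.exp (-κ) * (2 * (2 * (n : ℝ) + 1) ^ v)) := fun t κ => by
    have := measure_exists_mass_count_noise_le hT hvc h (ι := Fin n) hlam t κ
    rwa [Fintype.card_fin] at this
  have hsplit : ∀ z ∈ badSamples P 𝒜 e σ a b, z ∉ F1 →
      8 * b ≤ n ∧ z ∈ F (√(3 * a / (10 * b)) / σ) (a + b / 4) ∪ F 0 (4 / 3 * b) := by
    rintro z ⟨A, hA, hAm, hq0, hlarge, hbad⟩ hz1
    set N : ℝ := ((indexSet z A).card : ℝ) with hN
    set q : ℝ := n * P.fst.real A with hq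
    set M := |∑ i ∈ indexSet z A, e (z i)|
    have hN0 : 0 ≤ N := Nat.cast_nonneg _
    have hbad' : N * √(3 * σ ^ 2 * a / q) ≤ M := by
      rcases hbad with h0 | h0
      · rw [hN, h0]; simp [M]
      · exact h0.le
    have hNq : N < 2 / 3 * q := by
      by_contra! hge
      have hNpos : 0 < N := by linarith
      refine hz1 ⟨A, hA, Nat.cast_pos.1 hNpos, le_trans ?_ hbad'⟩
      rw [← hN]
      calc √(2 * σ ^ 2 * a * N) = √(N ^ 2 * (2 * σ ^ 2 * a / N)) := by congr 1; field_simp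
        _ = N * √(2 * σ ^ 2 * a / N) := by
          rw [Real.sqrt_mul (by positivity), Real.sqrt_sq hN0]
        _ ≤ N * √(3 * σ ^ 2 * a / q) := by
          gcongr N * √?_
          rw [div_le_div_iff₀ hNpos hq0]
          have : 0 ≤ σ ^ 2 * a := by positivity
          nlinarith
    have hq8 : 8 * b ≤ q := by
      rwa [max_eq_right (by linarith)] at hlarge
    refine ⟨hq8.trans ?_, ?_⟩
    · rw [hq]; exact mul_le_of_le_one_right hn0.le measureReal_le_one
    · rcases le_total q (40 * b) with h40 | h40
      · exact Or.inl ⟨A, hA, hAm,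
          add_div_four_le_exponent hσ ha0 hab hq8 h40 hN0 hNq.le hbad'⟩
      · refine Or.inr ⟨A, hA, hAm, ?_⟩
        have := four_thirds_mul_le_exponent (ha0.trans_le hab) h40 hNq.le
        simpa using this
  -- If `n < 8 b`, no set has mass `8 b` and only the first event can occur.
  by_cases hnb : 8 * b ≤ n
  · calc (Measure.pi fun _ : Fin n => P) (badSamples P 𝒜 e σ a b)
        ≤ (Measure.pi fun _ : Fin n => P)
          (F1 ∪ (F (√(3 * a / (10 * b)) / σ) (a + b / 4) ∪ F 0 (4 / 3 * b))) := by
          refine measure_mono fun z hz => ?_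
          by_cases hz1 : z ∈ F1
          · exact Or.inl hz1
          · exact Or.inr (hsplit z hz hz1).2
      _ ≤ ENNReal.ofReal (2 * δ) + (_ + _) := (measure_union_le _ _).trans <| by
          gcongr
          exact (measure_union_le _ _).trans (add_le_add (hPF _ _) (hPF _ _))
      _ ≤ ENNReal.ofReal (2 * δ) + ENNReal.ofReal δ := by
          rw [← ENNReal.ofReal_add (by positivity) (by positivity)]
          gcongr
          exact deviation_budget_le hn hv hδ0 hδ1 ha hb hnb
      _ = ENNReal.ofReal (3 * δ) := by
          rw [← ENNReal.ofReal_add (by positivity) hδ0.le]; congr 1; ring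
  · have : badSamples P 𝒜 e σ a b ⊆ F1 := fun z hz => by
      by_contra hz1
      exact hnb (hsplit z hz hz1).1
    exact (measure_mono this).trans (hP1.trans (ENNReal.ofReal_le_ofReal (by linarith)))

lemma measure_badSamples_le {d n v : ℕ} (hn : 1 ≤ n) (hv : 0 < v) {δ : ℝ} (hδ0 : 0 < δ)
    (hδ1 : δ < 1 / 3) {P : Measure (E d × ℝ)} [IsProbabilityMeasure P] {𝒜 : Set (Set (E d))}
    (hT : TraceMeasurable P.fst 𝒜) (hvc : vcDim 𝒜 ≤ v) {e : E d × ℝ → ℝ} {σ : ℝ}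
    (h : IsSubGaussianGiven P e σ) :
    (Measure.pi fun _ : Fin n => P) (badSamples P 𝒜 e σ (Real.log (((n : ℝ) + 1) ^ v / δ))
      (Real.log (4 * (2 * (n : ℝ) + 1) ^ v / δ))) ≤ ENNReal.ofReal (3 * δ) := by
  -- The exponents involve `1 / σ`. All `s > |σ|` are admissible, and the bad event for `σ` is the
  -- increasing union of the bad events for a sequence of such `s` decreasing to `|σ|`.
  set a := Real.log (((n : ℝ) + 1) ^ v / δ)
  set b := Real.log (4 * (2 * (n : ℝ) + 1) ^ v / δ)
  let s : ℕ → ℝ := fun k => |σ| + 1 / ((k : ℝ) + 1)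
  have hs0 : ∀ k, 0 < s k := fun k => by positivity
  have hsσ : ∀ k, |σ| ≤ s k := fun k => le_add_of_nonneg_right (by positivity)
  have ha0 : 0 ≤ a := by
    refine Real.log_nonneg ?_
    rw [le_div_iff₀ hδ0]
    have : (1 : ℝ) ≤ (n + 1) ^ v := one_le_pow₀ (by linarith [Nat.cast_nonneg (α := ℝ) n])
    linarith
  have hmono : Monotone fun k => badSamples (n := n) P 𝒜 e (s k) a b := by
    rintro k l hkl z ⟨A, hA, hAm, hq0, hlarge, hbad⟩
    refine ⟨A, hA, hAm, hq0, hlarge, hbad.imp_right fun hlt => lt_of_le_of_lt ?_ hlt⟩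
    have hsl : s l ≤ s k := by
      have : (k : ℝ) ≤ l := by exact_mod_cast hkl
      simp only [s]; gcongr
    have := (hs0 l).le
    gcongr
  have hsub : badSamples (n := n) P 𝒜 e σ a b ⊆ ⋃ k, badSamples P 𝒜 e (s k) a b := by
    rintro z ⟨A, hA, hAm, hq0, hlarge, hbad⟩
    rw [Set.mem_iUnion]
    rcases hbad with h0 | hlt
    · exact ⟨0, A, hA, hAm, hq0, hlarge, Or.inl h0⟩
    · have hlim : Filter.Tendsto (fun k => ((indexSet z A).card : ℝ)
          * √(3 * s k ^ 2 * a / (n * P.fst.real A))) Filter.atTop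
          (nhds ((indexSet z A).card * √(3 * |σ| ^ 2 * a / (n * P.fst.real A)))) := by
        have hs : Filter.Tendsto s Filter.atTop (nhds |σ|) := by
          simpa [s] using (tendsto_const_nhds (x := |σ|)).add
            (tendsto_one_div_add_atTop_nhds_zero_nat (𝕜 := ℝ))
        exact ((((hs.pow 2).const_mul 3).mul_const a).div_const _).sqrt.const_mul _
      rw [sq_abs] at hlim
      obtain ⟨k, hk⟩ := (hlim.eventually_lt_const hlt).exists
      exact ⟨k, A, hA, hAm, hq0, hlarge, Or.inr hk⟩
  refine (measure_mono hsub).trans ?_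
  rw [hmono.measure_iUnion]
  exact iSup_le fun k => measure_badSamples_le_of_pos hn hv hδ0 hδ1 hT hvc
    (h.mono (sq_le_sq.2 ((hsσ k).trans (le_abs_self _)))) (hs0 k)

/-! ### Error decomposition -/

lemma count_eq_card_indexSet {d n : ℕ} (z : Fin n → E d × ℝ) (A : Set (E d)) :
    count z A = (indexSet z A).card := by
  classical
  simp [count, indexSet, Set.indicator_apply]

lemma estimator_eq_sum_div {d n : ℕ} (z : Fin n → E d × ℝ) (V : E d → Set (E d)) (x : E d) :
    estimator z V x = (∑ i ∈ indexSet z (V x), (z i).2) / (indexSet z (V x)).card := by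
  classical
  rw [estimator, count_eq_card_indexSet]
  simp [indexSet, Set.indicator_apply, Finset.sum_filter]

/-- The infimum in the definition of `localLip` is attained. -/
lemma isLipschitzOnSet_localLip {d : ℕ} {g : E d → ℝ} {V : Set (E d)} {L : ℝ}
    (h : IsLipschitzOnSet V g L) : IsLipschitzOnSet V g (localLip g V) := by
  intro x hx y hy
  have hne : {K : ℝ | 0 ≤ K ∧ IsLipschitzOnSet V g K}.Nonempty :=
    ⟨max L 0, le_max_right _ _, fun x hx y hy => (h x hx y hy).trans <| by
      gcongr; exact le_max_left _ _⟩
  rcases (norm_nonneg (x - y)).eq_or_lt with h0 | h0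
  · have := h x hx y hy
    rw [← h0] at this ⊢
    simpa using this
  · rw [← div_le_iff₀ h0]
    exact le_csInf hne fun K hK => (div_le_iff₀ h0).2 (hK.2 x hx y hy)

/-- The bias of a local average is at most the oscillation `L(V) diam(V)`. -/
lemma ofReal_abs_sum_sub_div_le {d : ℕ} {ι : Type*} {g : E d → ℝ} {V : Set (E d)} {L : ℝ}
    (h : IsLipschitzOnSet V g L) {x : E d} (hx : x ∈ V) {J : Finset ι} (hJ : 0 < J.card)
    {u : ι → E d} (hu : ∀ i ∈ J, u i ∈ V) :
    ENNReal.ofReal |(∑ i ∈ J, (g (u i) - g x)) / J.card|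
      ≤ ENNReal.ofReal (localLip g V) * Metric.ediam V := by
  have hlip := isLipschitzOnSet_localLip h
  have hterm : ∀ i ∈ J, ENNReal.ofReal |g (u i) - g x|
      ≤ ENNReal.ofReal (localLip g V) * Metric.ediam V := fun i hi => by
    calc ENNReal.ofReal |g (u i) - g x|
        ≤ ENNReal.ofReal (localLip g V * ‖u i - x‖) :=
          ENNReal.ofReal_le_ofReal (hlip _ (hu i hi) _ hx)
      _ = ENNReal.ofReal (localLip g V) * edist (u i) x := by
          rw [ENNReal.ofReal_mul' (norm_nonneg _), edist_dist, dist_eq_norm]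
      _ ≤ _ := by gcongr; exact Metric.edist_le_ediam_of_mem (hu i hi) hx
  have hJ' : (0 : ℝ) < J.card := by exact_mod_cast hJ
  calc ENNReal.ofReal |(∑ i ∈ J, (g (u i) - g x)) / J.card|
      ≤ ENNReal.ofReal ((∑ i ∈ J, |g (u i) - g x|) / J.card) := by
        rw [abs_div, abs_of_pos hJ']
        gcongr
        exact Finset.abs_sum_le_sum_abs _ _
    _ = (∑ i ∈ J, ENNReal.ofReal |g (u i) - g x|) / J.card := by
        rw [ENNReal.ofReal_div_of_pos hJ', ENNReal.ofReal_sum_of_nonneg fun _ _ => abs_nonneg _,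
          ENNReal.ofReal_natCast]
    _ ≤ (J.card • (ENNReal.ofReal (localLip g V) * Metric.ediam V)) / J.card := by
        gcongr
        exact Finset.sum_le_card_nsmul _ _ _ hterm
    _ = _ := by
        rw [nsmul_eq_mul, mul_comm, ENNReal.mul_div_cancel_right (by exact_mod_cast hJ.ne') (by simp)]

/-- Off the bad event, the estimation error is at most the noise bound plus the bias bound. -/
lemma ofReal_abs_estimator_sub_le {d n : ℕ} (hn : 1 ≤ n) {P : Measure (E d × ℝ)}
    [IsProbabilityMeasure P] {𝒜 : Set (Set (E d))} {e : E d × ℝ → ℝ} {σ a b ℓ L : ℝ} (ha : 0 ≤ a)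
    {z : Fin n → E d × ℝ} (hz : z ∉ badSamples P 𝒜 e σ a b) {g : E d → ℝ}
    (he : ∀ i, e (z i) = (z i).2 - g (z i).1) {V : E d → Set (E d)} {x : E d}
    (hV : V x ∈ 𝒜) (hVm : MeasurableSet (V x)) (hx : x ∈ V x) (hvol : 0 < volume (V x))
    (hL : IsLipschitzOnSet (V x) g L) (hℓ : 0 < ℓ)
    (hmass : ENNReal.ofReal ℓ * volume (V x) ≤ P.fst (V x))
    (hlarge : 8 * b ≤ n * max (empMeasure z (V x)) (P.fst.real (V x))) :
    ENNReal.ofReal |estimator z V x - g x|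
      ≤ ENNReal.ofReal (√(3 * σ ^ 2 * a / (n * ℓ * volume.real (V x))))
        + ENNReal.ofReal (localLip g (V x)) * Metric.ediam (V x) := by
  have hn0 : (0 : ℝ) < n := by exact_mod_cast hn
  have hvoltop : volume (V x) ≠ ∞ := fun htop => by
    rw [htop, ENNReal.mul_top (by simpa using hℓ)] at hmass
    exact measure_ne_top P.fst (V x) (top_le_iff.1 hmass)
  have hvol' : 0 < volume.real (V x) := ENNReal.toReal_pos hvol.ne' hvoltop
  have hmass' : ℓ * volume.real (V x) ≤ P.fst.real (V x) := by
    have := ENNReal.toReal_mono (measure_ne_top P.fst (V x)) hmass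
    rwa [ENNReal.toReal_mul, ENNReal.toReal_ofReal hℓ.le] at this
  have hden : 0 < n * ℓ * volume.real (V x) := by positivity
  have hq : n * ℓ * volume.real (V x) ≤ n * P.fst.real (V x) := by
    rw [mul_assoc]; gcongr
  set J := indexSet z (V x) with hJdef
  have hlarge' : 8 * b ≤ max (J.card : ℝ) (n * P.fst.real (V x)) := by
    rwa [mul_max_of_nonneg _ _ hn0.le, empMeasure, mul_div_cancel₀ _ hn0.ne',
      count_eq_card_indexSet] at hlarge
  have hgood : ¬(J.card = 0 ∨ J.card * √(3 * σ ^ 2 * a / (n * P.fst.real (V x)))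
      < |∑ i ∈ J, e (z i)|) := fun hbad =>
    hz ⟨V x, hV, hVm, hden.trans_le hq, hlarge', hbad⟩
  rw [not_or, not_lt] at hgood
  obtain ⟨hJ0, hnoise⟩ := hgood
  have hJpos : 0 < J.card := Nat.pos_of_ne_zero hJ0
  have hJ' : (0 : ℝ) < J.card := by exact_mod_cast hJpos
  have hdecomp : estimator z V x - g x
      = (∑ i ∈ J, e (z i)) / J.card + (∑ i ∈ J, (g (z i).1 - g x)) / J.card := by
    rw [estimator_eq_sum_div, ← hJdef, ← add_div, ← Finset.sum_add_distrib, eq_div_iff hJ'.ne',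
      sub_mul, div_mul_cancel₀ _ hJ'.ne']
    simp only [he, sub_add_sub_cancel]
    rw [Finset.sum_sub_distrib]
    simp [mul_comm]
  have hnoise' : |(∑ i ∈ J, e (z i)) / J.card|
      ≤ √(3 * σ ^ 2 * a / (n * ℓ * volume.real (V x))) := by
    rw [abs_div, abs_of_pos hJ', div_le_iff₀ hJ', mul_comm]
    refine hnoise.trans ?_
    gcongr
  rw [hdecomp]
  calc ENNReal.ofReal |(∑ i ∈ J, e (z i)) / J.card + (∑ i ∈ J, (g (z i).1 - g x)) / J.card|
      ≤ ENNReal.ofReal |(∑ i ∈ J, e (z i)) / J.card|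
        + ENNReal.ofReal |(∑ i ∈ J, (g (z i).1 - g x)) / J.card| :=
        (ENNReal.ofReal_le_ofReal (abs_add_le _ _)).trans ENNReal.ofReal_add_le
    _ ≤ _ := by
        refine add_le_add (ENNReal.ofReal_le_ofReal hnoise') ?_
        refine ofReal_abs_sum_sub_div_le hL hx hJpos fun i hi => ?_
        have : i ∈ (indexSet z (V x) : Set (Fin n)) := hi
        rwa [coe_indexSet] at this

end LocalReg

theorem mainTheorem4 {d n v : ℕ} (hd : 1 ≤ d) (hn : 1 ≤ n) (hv : 0 < v)
    {δ : ℝ} (hδ0 : 0 < δ) (hδ1 : δ < 1 / 3)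
    {Ω : Type*} [MeasurableSpace Ω] (μ : Measure Ω) [IsProbabilityMeasure μ]
    (P : Measure (LocalReg.E d × ℝ)) [IsProbabilityMeasure P]
    (S : Set (LocalReg.E d)) (hS : MeasurableSet S) (hPS : ∀ᵐ p ∂P, p.1 ∈ S)
    (g : LocalReg.E d → ℝ) (hg : LocalReg.IsRegressionFunction P g)
    (σ : ℝ) (hE : LocalReg.SubGaussianNoise P g σ)
    (Z : Fin n → Ω → LocalReg.E d × ℝ) (hD : LocalReg.IsIIDSample μ P Z)
    (L : ℝ) (hL : LocalReg.IsLipschitzOnSet S g L)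
    (𝒱 : Ω → LocalReg.E d → Set (LocalReg.E d)) (h𝒱 : ∀ ω, LocalReg.IsLocalMap S (𝒱 ω))
    (hVC : LocalReg.IsVCLocalMap P.fst S 𝒱 v)
    (ℓ : LocalReg.E d → ℝ) (hX : LocalReg.MinimalMass μ P.fst S 𝒱 ℓ)
    (hlarge : LocalReg.IsLarge μ P.fst Z S 𝒱 v δ) :
    ∃ G : Set Ω, MeasurableSet G ∧ ENNReal.ofReal (1 - 3 * δ) ≤ μ G ∧
      ∀ ω ∈ G, ∀ x ∈ S,
        ENNReal.ofReal |LocalReg.estimator (fun i => Z i ω) (𝒱 ω) x - g x|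
          ≤ ENNReal.ofReal (Real.sqrt (3 * σ ^ 2 * Real.log (((n : ℝ) + 1) ^ v / δ)
                / (n * ℓ x * volume.real (𝒱 ω x))))
            + ENNReal.ofReal (LocalReg.localLip g (𝒱 ω x)) * Metric.ediam (𝒱 ω x) := by
  obtain ⟨𝒜, hvc, hT, h𝒜⟩ := hVC
  obtain ⟨e, hee, he⟩ := hE.exists_isSubGaussianGiven
  obtain ⟨hZ, hZP, hindep⟩ := hD
  obtain ⟨hℓ, hmass⟩ := hX
  set a := Real.log (((n : ℝ) + 1) ^ v / δ)
  set b := Real.log (4 * (2 * (n : ℝ) + 1) ^ v / δ)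
  have ha : 0 ≤ a := by
    refine Real.log_nonneg ?_
    rw [le_div_iff₀ hδ0]
    have : (1 : ℝ) ≤ (n + 1) ^ v := one_le_pow₀ (by linarith [Nat.cast_nonneg (α := ℝ) n])
    linarith
  have hZm : Measurable fun ω i => Z i ω := measurable_pi_iff.2 hZ
  have hlaw : μ.map (fun ω i => Z i ω) = Measure.pi fun _ : Fin n => P := by
    rw [(iIndepFun_iff_map_fun_eq_pi_map fun i => (hZ i).aemeasurable).1 hindep]
    simp_rw [hZP]
  have hnoise : ∀ᵐ ω ∂μ, ∀ i, e (Z i ω) = (Z i ω).2 - g (Z i ω).1 := by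
    refine ae_all_iff.2 fun i => ae_of_ae_map (hZ i).aemeasurable
      (p := fun p : LocalReg.E d × ℝ => e p = p.2 - g p.1) ?_
    rw [hZP i]
    exact hee
  have hbad : μ {ω | (fun i => Z i ω) ∈ LocalReg.badSamples P 𝒜 e σ a b}
      ≤ ENNReal.ofReal (3 * δ) := by
    refine le_trans ?_ (LocalReg.measure_badSamples_le hn hv hδ0 hδ1 hT hvc.le he)
    rw [← hlaw]
    exact Measure.le_map_apply hZm.aemeasurable _
  set good : Set Ω := {ω | (∀ x ∈ S, ENNReal.ofReal (ℓ x) * volume (𝒱 ω x) ≤ P.fst (𝒱 ω x)) ∧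
    (∀ x ∈ S, 8 * b ≤ n * max (LocalReg.empMeasure (fun i => Z i ω) (𝒱 ω x))
      (P.fst.real (𝒱 ω x))) ∧ ∀ i, e (Z i ω) = (Z i ω).2 - g (Z i ω).1} with hgood
  have hgoodae : μ goodᶜ = 0 := by
    rw [← mem_ae_iff]
    filter_upwards [hmass, hlarge, hnoise] with ω h1 h2 h3 using ⟨h1, h2, h3⟩
  set U : Set Ω := {ω | (fun i => Z i ω) ∈ LocalReg.badSamples P 𝒜 e σ a b} ∪ goodᶜ with hU
  -- The bad event need not be measurable: take the complement of a measurable hull of it.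
  refine ⟨(toMeasurable μ U)ᶜ, (measurableSet_toMeasurable _ _).compl, ?_, fun ω hω x hx => ?_⟩
  · rw [prob_compl_eq_one_sub (measurableSet_toMeasurable _ _), measure_toMeasurable,
      ENNReal.ofReal_sub _ (by positivity), ENNReal.ofReal_one]
    gcongr
    refine (measure_union_le _ _).trans ?_
    rw [hgoodae, add_zero]
    exact hbad
  · have hωU : ω ∉ U := fun h => hω (subset_toMeasurable _ _ h)
    rw [hU, Set.mem_union, not_or, Set.notMem_compl_iff] at hωU
    obtain ⟨hωbad, h1, h2, h3⟩ := hωU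
    obtain ⟨hVm, hVS, hxV, hvol⟩ := h𝒱 ω x hx
    exact LocalReg.ofReal_abs_estimator_sub_le hn ha hωbad h3 (h𝒜 ω x hx) hVm hxV hvol
      (fun y hy w hw => hL y (hVS hy) w (hVS hw)) (hℓ x hx) (h1 x hx) (h2 x hx)
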